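/- **Setting.** For a simplicial complex $K$ let $K_q$ be the set of ordered $q$-simplices $\sigma=(v_0,\dots,v_q)$ of $K$, i.e. families of vertices, in any order and with repetitions allowed, which span a simplex of $K$; for $0\le i\le q$ let $\varepsilon_i(\sigma)\in K_{q-1}$ be obtained by omitting $v_i$, and let $\varepsilon^i:\Delta^{q-1}\to\Delta^q$ be the inclusion of the $i$-th face of the standard simplex. $C_q(K)$ is the real vector space with basis $K_q$, and $A^k(\Delta^q)$ is the space of smooth (up to the boundary) real $k$-forms on $\Delta^q$. $A^k(K)$ is the space of piecewise smooth $k$-forms on $K$: families $\varphi_\sigma\in A^k(\Delta^q)$, $\sigma\in K_q$, $q\ge0$, with $\varphi_{\sigma\circ\theta}=\theta^*\varphi_\sigma$ for all the affine maps $\theta:\Delta^p\to\Delta^q$ given by maps $\theta$ between vertices (one form on each geometric simplex, compatible with restriction to faces). $A^\bullet(K)=\bigoplus_k A^k(K)$ is a dg-algebra. The Dupont complex of $K$ is $$Du_n(K)=\bigoplus_{j\ge0}A^j(\Delta^{n+j})\otimes_{\mathbb R} C_{n+j}(K),\qquad \partial(\omega\otimes\sigma)=(-1)^n d\omega\otimes\sigma+\sum_{i}(-1)^i(\varepsilon^i)^*\omega\otimes\varepsilon_i(\sigma)\quad(n\ge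 1),$$ with the product $A^k(K)\times Du_{n+k}(K)\to Du_n(K)$, $\varphi\cdot(\omega\otimes\sigma)=(\varphi_\sigma\wedge\omega)\otimes\sigma$. A simplicial map $f:K\to K'$ induces the chain map $f_\bullet:Du_\bullet(K)\to Du_\bullet(K')$, $\omega\otimes\sigma\mapsto\omega\otimes f(\sigma)$, and the morphism $f^*:A^\bullet(K')\to A^\bullet(K)$, $(f^*\varphi)_\sigma=\varphi_{f(\sigma)}$. Let $K$ be connected with a vertex $k_0$ as base point, let $\pi_1(K)=\pi_1(|K|,k_0)$, let $\widetilde K\to K$ be the universal covering with its induced simplicial structure, on which $\pi_1(K)$ acts on the right by covering transformations, and let $\rho:\pi_1(K)\to \mathrm{Aut}(E)$ be a representation on a finite dimensional real or complex vector space. Put $\mathfrak m^n(K,E)=\mathrm{Hom}_{\mathbb R[\pi_1(K)]}(Du_n(\widetilde K),E)$, that is, the real linear maps $\alpha$ with $\alpha(x\cdot g)=\rho(g)^{-1}\alpha(x)$; put $(\partial\alpha)(x)=\alpha(\partial x)$, and let $\varphi\in A^k(K)$ act by $(\varphi\cdot\alpha)(x)=(-1)^{kn}\alpha(\varphi\cdot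 x)$ for $\alpha\in\mathfrak m^n(K,E)$, where $\varphi$ is pulled back to $\widetilde K$. Put $\mathfrak m^\bullet(K,E)=\bigoplus_n\mathfrak m^n(K,E)$. For a closed $t\in\bigoplus_{i\ge1}A^{2i+1}(K)$ put $\partial_t=\partial+t\cdot$, and let $H^{ev}(K,E,t)$, $H^{od}(K,E,t)$ be the even and odd cohomology of the $\mathbb Z/2$-graded complex $(\mathfrak m^\bullet(K,E),\partial_t)$. **Proposition (functoriality).** (i) Let $f:K\to L$ be a simplicial map between connected simplicial complexes, $k_0$ a vertex of $K$, $\rho:\pi_1(L,f(k_0))\to\mathrm{Aut}(E)$ a finite dimensional real or complex representation, and $t_L\in\bigoplus_{i\ge1}A^{2i+1}(L)$ closed. Then $t_K=f^*t_L$ is closed and lies in $\bigoplus_{i\ge1}A^{2i+1}(K)$, and for $\bullet=ev,od$, $f$ induces linear maps $$f^\bullet:H^\bullet(L,E,t_L)\to H^\bullet(K,f^*E,t_K),\qquad [\alpha]\mapsto[\alpha\circ\widetilde f_\bullet],$$ where $f^*E$ is the representation $\pi_1(K,k_0)\xrightarrow{f_*}\pi_1(L,f(k_0))\to\mathrm{Aut}(E)$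 and $\widetilde f:\widetilde K\to\widetilde L$ is the lift of $f$ which preserves base points; in particular $\alpha\circ\widetilde f_\bullet$ is a cocycle whenever $\alpha$ is. (ii) If $g:J\to K$ is another simplicial map, $J$ is connected, and the base points are $j_0$, $g(j_0)$, $f(g(j_0))$, then $(f\circ g)^*E=g^*f^*E$, $(f\circ g)^*t_L=g^*f^*t_L$, and $(f\circ g)^\bullet=g^\bullet\circ f^\bullet$ for $\bullet=ev,od$. Moreover $\mathrm{id}^\bullet=\mathrm{id}$. Thus twisted cohomology is a contravariant functor. -/

import Mathlib

open scoped ContDiff TensorProduct DirectSum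

noncomputable section

namespace TwistedCohomology

/-! ## Smooth differential forms on the standard simplices -/

/-- The standard `q`-simplex `Δ^q`, in the affine coordinates `(x_1, …, x_q)` (the remaining
barycentric coordinate is `x_0 = 1 - x_1 - … - x_q`). -/
def simplex (q : ℕ) : Set (Fin q → ℝ) := {x | (∀ i, 0 ≤ x i) ∧ ∑ i, x i ≤ 1}

theorem convex_simplex (q : ℕ) : Convex ℝ (simplex q) := by
  intro x hx y hy a b ha hb hab
  refine ⟨fun i => ?_, ?_⟩
  · have h1 := mul_nonneg ha (hx.1 i)
    have h2 := mul_nonneg hb (hy.1 i)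
    simpa using add_nonneg h1 h2
  · have h1 := mul_le_mul_of_nonneg_left hx.2 ha
    have h2 := mul_le_mul_of_nonneg_left hy.2 hb
    simp only [Pi.add_apply, Pi.smul_apply, smul_eq_mul, Finset.sum_add_distrib,
      ← Finset.mul_sum]
    linarith

theorem interior_simplex_nonempty (q : ℕ) : (interior (simplex q)).Nonempty := by
  let U : Set (Fin q → ℝ) := {x | (∀ i, 0 < x i) ∧ ∑ i, x i < 1}
  have hU : IsOpen U := by
    have h1 : IsOpen {x : Fin q → ℝ | ∀ i, 0 < x i} := by
      simp only [Set.ofPred_forall]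
      exact isOpen_iInter_of_finite fun i => isOpen_lt continuous_const (continuous_apply i)
    exact h1.inter (isOpen_lt (f := fun x : Fin q → ℝ => ∑ i, x i) (by fun_prop) continuous_const)
  have hsub : U ⊆ simplex q := fun x hx => ⟨fun i => (hx.1 i).le, hx.2.le⟩
  refine ⟨fun _ => 1 / (q + 1 : ℝ), interior_maximal hsub hU ⟨fun i => by positivity, ?_⟩⟩
  have : (0 : ℝ) < q + 1 := by positivity
  simp only [Finset.sum_const, Finset.card_univ, Fintype.card_fin, nsmul_eq_mul]
  rw [mul_one_div, div_lt_one this]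
  linarith

theorem uniqueDiffOn_simplex (q : ℕ) : UniqueDiffOn ℝ (simplex q) :=
  uniqueDiffOn_convex (convex_simplex q) (interior_simplex_nonempty q)

theorem simplex_subset_closure_interior (q : ℕ) :
    simplex q ⊆ closure (interior (simplex q)) := by
  rw [(convex_simplex q).closure_interior_eq_closure_of_nonempty_interior
    (interior_simplex_nonempty q)]
  exact subset_closure

/-- The `i`-th vertex of `Δ^q`. -/
def vertex {q : ℕ} (i : Fin (q + 1)) : Fin q → ℝ := fun j => if i = j.succ then 1 else 0

/-- Linear part of the affine map `Δ^p → Δ^q` which is given on vertices by `θ`. -/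
def simplexMapLin {p q : ℕ} (θ : Fin (p + 1) → Fin (q + 1)) : (Fin p → ℝ) →L[ℝ] (Fin q → ℝ) :=
  ∑ i : Fin p, (ContinuousLinearMap.proj (R := ℝ) (φ := fun _ : Fin p => ℝ) i).smulRight
    (vertex (θ i.succ) - vertex (θ 0))

/-- The affine map `Δ^p → Δ^q` which is given on vertices by `θ`. -/
def simplexMap {p q : ℕ} (θ : Fin (p + 1) → Fin (q + 1)) (x : Fin p → ℝ) : Fin q → ℝ :=
  vertex (θ 0) + simplexMapLin θ x

theorem simplexMap_eq {p q : ℕ} (θ : Fin (p + 1) → Fin (q + 1)) (x : Fin p → ℝ) :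
    simplexMap θ x = (1 - ∑ i, x i) • vertex (θ 0) + ∑ i : Fin p, x i • vertex (θ i.succ) := by
  simp only [simplexMap, simplexMapLin, sum_apply,
    ContinuousLinearMap.smulRight_apply, ContinuousLinearMap.proj_apply, smul_sub,
    Finset.sum_sub_distrib, ← Finset.sum_smul, sub_smul, one_smul]
  abel

theorem vertex_mem {q : ℕ} (i : Fin (q + 1)) : vertex i ∈ simplex q := by
  refine ⟨fun j => by unfold vertex; split_ifs <;> norm_num, ?_⟩
  unfold vertex
  refine Fin.cases ?_ (fun k => ?_) i
  · simp [Fin.succ_ne_zero, eq_comm]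
  · simp

theorem mapsTo_simplexMap {p q : ℕ} (θ : Fin (p + 1) → Fin (q + 1)) :
    Set.MapsTo (simplexMap θ) (simplex p) (simplex q) := by
  intro x hx
  rw [simplexMap_eq]
  have key := (convex_simplex q).sum_mem (t := Finset.univ)
    (w := fun i : Fin (p + 1) => (Fin.cons (1 - ∑ i, x i) x : Fin (p + 1) → ℝ) i)
    (z := fun i => vertex (θ i)) ?_ ?_ (fun i _ => vertex_mem _)
  · rw [Fin.sum_univ_succ] at key
    simpa using key
  · intro i _
    refine Fin.cases ?_ (fun k => ?_) i
    · simpa using hx.2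
    · simpa using hx.1 k
  · rw [Fin.sum_univ_succ]
    simp

theorem hasFDerivAt_simplexMap {p q : ℕ} (θ : Fin (p + 1) → Fin (q + 1)) (x : Fin p → ℝ) :
    HasFDerivAt (simplexMap θ) (simplexMapLin θ) x :=
  (simplexMapLin θ).hasFDerivAt.const_add _

theorem contDiff_simplexMap {p q : ℕ} (θ : Fin (p + 1) → Fin (q + 1)) :
    ContDiff ℝ ∞ (simplexMap θ) :=
  contDiff_const.add (simplexMapLin θ).contDiff

/-- `A^k(Δ^q)`: the real vector space of smooth (up to the boundary) differential `k`-forms on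
`Δ^q`. A form is recorded as a function on `ℝ^q` which vanishes outside of `Δ^q`, so that two forms
are equal if and only if they agree on `Δ^q`. -/
def Form (q k : ℕ) : Submodule ℝ ((Fin q → ℝ) → (Fin q → ℝ) [⋀^Fin k]→L[ℝ] ℝ) where
  carrier := {w | ContDiffOn ℝ ∞ w (simplex q) ∧ ∀ x ∉ simplex q, w x = 0}
  add_mem' := fun ha hb => ⟨ha.1.add hb.1, fun x hx => by simp [ha.2 x hx, hb.2 x hx]⟩
  zero_mem' := ⟨contDiffOn_const, fun _ _ => rfl⟩
  smul_mem' := fun c w h => ⟨contDiffOn_const.smul h.1, fun x hx => by simp [h.2 x hx]⟩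

theorem Form.ext_on {q k : ℕ} {w w' : Form q k} (h : ∀ x ∈ simplex q, w.1 x = w'.1 x) : w = w' := by
  apply Subtype.ext
  funext x
  by_cases hx : x ∈ simplex q
  · exact h x hx
  · rw [w.2.2 x hx, w'.2.2 x hx]

theorem Form.differentiableWithinAt {q k : ℕ} (w : Form q k) {x : Fin q → ℝ}
    (hx : x ∈ simplex q) :
    DifferentiableWithinAt ℝ w.1 (simplex q) x :=
  (w.2.1.differentiableOn (by simp)) x hx

open scoped Classical in
/-- A function which is smooth on `Δ^q`, viewed as a form on `Δ^q`. -/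
def Form.mk {q k : ℕ} (u : (Fin q → ℝ) → (Fin q → ℝ) [⋀^Fin k]→L[ℝ] ℝ)
    (hu : ContDiffOn ℝ ∞ u (simplex q)) : Form q k :=
  ⟨(simplex q).indicator u, hu.congr fun _ hx => Set.indicator_of_mem hx _,
    fun _ hx => Set.indicator_of_notMem hx _⟩

theorem Form.mk_apply {q k : ℕ} {u : (Fin q → ℝ) → (Fin q → ℝ) [⋀^Fin k]→L[ℝ] ℝ}
    {x : Fin q → ℝ} (hx : x ∈ simplex q) (hu : ContDiffOn ℝ ∞ u (simplex q)) :
    (Form.mk u hu).1 x = u x :=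
  Set.indicator_of_mem hx _

theorem Form.contDiffOn_d {q k : ℕ} (w : Form q k) :
    ContDiffOn ℝ ∞ (extDerivWithin w.1 (simplex q)) (simplex q) := by
  have h : ContDiffOn ℝ ∞ (fderivWithin ℝ w.1 (simplex q)) (simplex q) :=
    w.2.1.fderivWithin (uniqueDiffOn_simplex q) (by simp)
  exact (ContinuousAlternatingMap.alternatizeUncurryFinCLM ℝ (Fin q → ℝ) ℝ
    (n := k)).contDiff.comp_contDiffOn h

/-- The exterior derivative `d : A^k(Δ^q) → A^{k+1}(Δ^q)`. -/
def Form.d (q k : ℕ) : Form q k →ₗ[ℝ] Form q (k + 1) where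
  toFun w := Form.mk (extDerivWithin w.1 (simplex q)) (Form.contDiffOn_d w)
  map_add' w w' := Form.ext_on fun x hx => by
    simp only [Form.mk_apply, hx, Submodule.coe_add, Pi.add_apply]
    exact extDerivWithin_add (uniqueDiffOn_simplex q x hx) (Form.differentiableWithinAt w hx)
      (Form.differentiableWithinAt w' hx)
  map_smul' c w := Form.ext_on fun x hx => by
    simp only [Form.mk_apply, hx, Submodule.coe_smul, Pi.smul_apply, RingHom.id_apply]
    exact extDerivWithin_smul c w.1 (uniqueDiffOn_simplex q x hx)

theorem Form.contDiffOn_pullback {p q k : ℕ} (θ : Fin (p + 1) → Fin (q + 1)) (w : Form q k) :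
    ContDiffOn ℝ ∞ (fun x => (w.1 (simplexMap θ x)).compContinuousLinearMap (simplexMapLin θ))
      (simplex p) := by
  have h : ContDiffOn ℝ ∞ (fun x => w.1 (simplexMap θ x)) (simplex p) :=
    w.2.1.comp (contDiff_simplexMap θ).contDiffOn (mapsTo_simplexMap θ)
  exact (ContinuousAlternatingMap.compContinuousLinearMapCLM (F := ℝ) (ι := Fin k)
    (simplexMapLin θ)).contDiff.comp_contDiffOn h

/-- The pull-back `A^k(Δ^q) → A^k(Δ^p)` along the affine map `Δ^p → Δ^q` given on vertices by
`θ`. -/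
def Form.pullback {p q : ℕ} (θ : Fin (p + 1) → Fin (q + 1)) (k : ℕ) :
    Form q k →ₗ[ℝ] Form p k where
  toFun w := Form.mk
    (fun x => (w.1 (simplexMap θ x)).compContinuousLinearMap (simplexMapLin θ))
    (Form.contDiffOn_pullback θ w)
  map_add' w w' := Form.ext_on fun x hx => by
    simp only [Form.mk_apply, hx, Submodule.coe_add, Pi.add_apply]
    rfl
  map_smul' c w := Form.ext_on fun x hx => by
    simp only [Form.mk_apply, hx, Submodule.coe_smul, Pi.smul_apply, RingHom.id_apply]
    rfl

theorem Form.d_pullback {p q : ℕ} (θ : Fin (p + 1) → Fin (q + 1)) (k : ℕ) (w : Form q k) :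
    Form.d p k (Form.pullback θ k w) = Form.pullback θ (k + 1) (Form.d q k w) := by
  refine Form.ext_on fun x hx => ?_
  have hu := uniqueDiffOn_simplex p
  have hf : ∀ y ∈ simplex p, fderivWithin ℝ (simplexMap θ) (simplex p) y = simplexMapLin θ :=
    fun y hy => (hasFDerivAt_simplexMap θ y).hasFDerivWithinAt.fderivWithin (hu y hy)
  have key := extDerivWithin_pullback (𝕜 := ℝ) (r := ∞) (f := simplexMap θ) (s := simplex p)
    (t := simplex q) (x := x) (Form.differentiableWithinAt w (mapsTo_simplexMap θ hx))
    (contDiff_simplexMap θ).contDiffWithinAt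
    (by
      rw [minSmoothness_of_isRCLikeNormedField]
      exact WithTop.coe_le_coe.2 (le_top (a := (2 : ℕ∞)))) hu
    (simplex_subset_closure_interior p hx) hx (mapsTo_simplexMap θ)
  simp only [Form.d, Form.pullback, LinearMap.coe_mk, AddHom.coe_mk, Form.mk_apply hx,
    Form.mk_apply (mapsTo_simplexMap θ hx)]
  rw [hf x hx] at key
  rw [← key]
  refine extDerivWithin_congr' (fun y hy => ?_) hx
  rw [Form.mk_apply hy, hf y hy]


theorem continuous_alternatingMap {q m : ℕ} (f : (Fin q → ℝ) [⋀^Fin m]→ₗ[ℝ] ℝ) :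
    Continuous f := by
  have h : ⇑f = fun v : Fin m → Fin q → ℝ =>
      ∑ r : Fin m → Fin q, (∏ i, v i (r i)) • f (fun i => Pi.single (r i) 1) := by
    funext v
    have h1 : v = fun i => ∑ j, v i j • (Pi.single j 1 : Fin q → ℝ) := by
      funext i
      exact pi_eq_sum_univ' (v i)
    conv_lhs => rw [h1]
    change f.toMultilinearMap _ = _
    rw [MultilinearMap.map_sum]
    exact Finset.sum_congr rfl fun r _ => f.toMultilinearMap.map_smul_univ _ _
  rw [h]
  fun_prop

/-- The exterior product of alternating forms,
`(a ∧ b)(v_1, …, v_{k+l}) = ∑_σ sign(σ) a(v_σ(1), …, v_σ(k)) b(v_σ(k+1), …, v_σ(k+l))`,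
the sum being over the `(k, l)`-shuffles `σ`. -/
def altWedge (q k l : ℕ) :
    ((Fin q → ℝ) [⋀^Fin k]→L[ℝ] ℝ) →ₗ[ℝ] ((Fin q → ℝ) [⋀^Fin l]→L[ℝ] ℝ) →ₗ[ℝ]
      ((Fin q → ℝ) [⋀^Fin (k + l)]→L[ℝ] ℝ) :=
  LinearMap.mk₂ ℝ
    (fun a b =>
      let c := ((LinearMap.mul' ℝ ℝ).compAlternatingMap
        (a.toAlternatingMap.domCoprod b.toAlternatingMap)).domDomCongr finSumFinEquiv
      { c with cont := continuous_alternatingMap c })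
    (fun a a' b => by
      ext v
      have := AlternatingMap.domCoprod'.map_add (a.toAlternatingMap ⊗ₜ[ℝ] b.toAlternatingMap)
        (a'.toAlternatingMap ⊗ₜ[ℝ] b.toAlternatingMap)
      rw [← TensorProduct.add_tmul] at this
      exact (congrArg (fun f => LinearMap.mul' ℝ ℝ (f (fun i => v (finSumFinEquiv i)))) this).trans
        (map_add _ _ _))
    (fun r a b => by
      ext v
      have := AlternatingMap.domCoprod'.map_smul r
        (a.toAlternatingMap ⊗ₜ[ℝ] b.toAlternatingMap)
      rw [TensorProduct.smul_tmul'] at this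
      exact (congrArg (fun f => LinearMap.mul' ℝ ℝ (f (fun i => v (finSumFinEquiv i)))) this).trans
        (map_smul _ _ _))
    (fun a b b' => by
      ext v
      have := AlternatingMap.domCoprod'.map_add (a.toAlternatingMap ⊗ₜ[ℝ] b.toAlternatingMap)
        (a.toAlternatingMap ⊗ₜ[ℝ] b'.toAlternatingMap)
      rw [← TensorProduct.tmul_add] at this
      exact (congrArg (fun f => LinearMap.mul' ℝ ℝ (f (fun i => v (finSumFinEquiv i)))) this).trans
        (map_add _ _ _))
    (fun r a b => by
      ext v
      have := AlternatingMap.domCoprod'.map_smul r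
        (a.toAlternatingMap ⊗ₜ[ℝ] b.toAlternatingMap)
      rw [← TensorProduct.tmul_smul] at this
      exact (congrArg (fun f => LinearMap.mul' ℝ ℝ (f (fun i => v (finSumFinEquiv i)))) this).trans
        (map_smul _ _ _))

theorem finiteDimensional_alt (q m : ℕ) :
    FiniteDimensional ℝ ((Fin q → ℝ) [⋀^Fin m]→L[ℝ] ℝ) := by
  let i : ((Fin q → ℝ) [⋀^Fin m]→L[ℝ] ℝ) →ₗ[ℝ]
      MultilinearMap ℝ (fun _ : Fin m => (Fin q → ℝ)) ℝ :=
    { toFun := fun a => a.toMultilinearMap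
      map_add' := fun _ _ => rfl
      map_smul' := fun _ _ => rfl }
  refine FiniteDimensional.of_injective i fun a b h => ?_
  ext v
  exact congrArg (fun f => f v) h

theorem Form.contDiffOn_wedge {q k l : ℕ} (a : Form q k) (b : Form q l) :
    ContDiffOn ℝ ∞ (fun x => altWedge q k l (a.1 x) (b.1 x)) (simplex q) := by
  have := finiteDimensional_alt q k
  have := finiteDimensional_alt q l
  exact ((altWedge q k l).toContinuousBilinearMap.contDiff.comp_contDiffOn a.2.1).clm_apply b.2.1

/-- The exterior product `A^k(Δ^q) × A^l(Δ^q) → A^{k+l}(Δ^q)` of forms. -/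
def Form.wedge (q k l : ℕ) : Form q k →ₗ[ℝ] Form q l →ₗ[ℝ] Form q (k + l) :=
  LinearMap.mk₂ ℝ
    (fun a b => Form.mk (fun x => altWedge q k l (a.1 x) (b.1 x)) (Form.contDiffOn_wedge a b))
    (fun a a' b => Form.ext_on fun x hx => by simp [Form.mk_apply, hx])
    (fun r a b => Form.ext_on fun x hx => by simp [Form.mk_apply, hx])
    (fun a b b' => Form.ext_on fun x hx => by simp [Form.mk_apply, hx])
    (fun r a b => Form.ext_on fun x hx => by simp [Form.mk_apply, hx])

/-! ## Simplicial complexes, simplicial maps, ordered simplices -/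

universe u v w

section Complexes

variable {V W X : Type u}

open scoped Classical in
/-- A simplicial map `K → L`: a map between the sets of vertices which maps simplexes onto
simplexes (it may be non-injective on a simplex). -/
@[ext]
structure SimplicialMap (K : AbstractSimplicialComplex V) (L : AbstractSimplicialComplex W) where
  /-- the map on vertices -/
  toFun : V → W
  map_faces : ∀ s ∈ K.faces, s.image toFun ∈ L.faces

open scoped Classical in
/-- The identity simplicial map. -/
def SimplicialMap.id (K : AbstractSimplicialComplex V) : SimplicialMap K K where
  toFun v := v
  map_faces s hs := by simpa using hs

open scoped Classical in
/-- The composition `f ∘ g` of simplicial maps. -/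
def SimplicialMap.comp {J : AbstractSimplicialComplex V} {K : AbstractSimplicialComplex W}
    {L : AbstractSimplicialComplex X} (f : SimplicialMap K L) (g : SimplicialMap J K) :
    SimplicialMap J L where
  toFun v := f.toFun (g.toFun v)
  map_faces s hs := by
    have h := f.map_faces _ (g.map_faces s hs)
    rw [Finset.image_image] at h
    exact h

theorem subset_mem_faces (K : AbstractSimplicialComplex V) {s t : Finset V} (hs : s ∈ K.faces)
    (hts : t ⊆ s) (ht : t.Nonempty) : t ∈ K.faces :=
  (K.isRelLowerSet_faces hs).2 hts ht

open scoped Classical in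
/-- `K_q`: the ordered `q`-simplexes `(v_0, …, v_q)` of `K`, that is, the families of vertices (in
any order, repetitions being allowed) which span a simplex of `K`. -/
@[ext]
structure OrdSimplex (K : AbstractSimplicialComplex V) (q : ℕ) where
  /-- the family `(v_0, …, v_q)` -/
  vert : Fin (q + 1) → V
  mem_faces : Finset.univ.image vert ∈ K.faces

open scoped Classical in
/-- The ordered simplex `(v_θ(0), …, v_θ(p))` for `σ = (v_0, …, v_q)`. The faces `ε_i(σ)` are the
case where `θ` is the increasing map which omits `i`. -/
def OrdSimplex.reindex {K : AbstractSimplicialComplex V} {p q : ℕ} (σ : OrdSimplex K q)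
    (θ : Fin (p + 1) → Fin (q + 1)) : OrdSimplex K p :=
  ⟨fun i => σ.vert (θ i), subset_mem_faces K σ.mem_faces (by
    intro v hv
    simp only [Finset.mem_image, Finset.mem_univ, true_and] at hv ⊢
    obtain ⟨i, hi⟩ := hv
    exact ⟨θ i, hi⟩) (Finset.univ_nonempty.image _)⟩

/-- The `i`-th face `ε_i(σ)`. -/
def OrdSimplex.face {K : AbstractSimplicialComplex V} {q : ℕ} (i : Fin (q + 2))
    (σ : OrdSimplex K (q + 1)) : OrdSimplex K q :=
  σ.reindex i.succAbove

open scoped Classical in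
/-- The map `K_q → L_q` induced by a simplicial map `f : K → L`. -/
def SimplicialMap.onSimplex {K : AbstractSimplicialComplex V} {L : AbstractSimplicialComplex W}
    (f : SimplicialMap K L) {q : ℕ} (σ : OrdSimplex K q) : OrdSimplex L q :=
  ⟨fun i => f.toFun (σ.vert i), by
    have h := f.map_faces _ σ.mem_faces
    rw [Finset.image_image] at h
    exact h⟩

/-! ## Piecewise smooth differential forms on a simplicial complex -/

/-- `A^k(K)`: the piecewise smooth `k`-forms on `K`, i.e. the families of forms `φ_σ ∈ A^k(Δ^q)`,
`σ ∈ K_q`, `q ≥ 0`, which are compatible with passing to faces. Since `K_q` contains a simplex with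
all the orderings of its vertices, and with repetitions, compatibility is with all the affine maps
`Δ^p → Δ^q` given by maps between vertices: `φ` amounts to one form on each geometric simplex
of `K`, compatible with restrictions to faces. -/
def Forms (K : AbstractSimplicialComplex V) (k : ℕ) :
    Submodule ℝ ((q : ℕ) → OrdSimplex K q → Form q k) where
  carrier := {φ | ∀ (p q : ℕ) (θ : Fin (p + 1) → Fin (q + 1)) (σ : OrdSimplex K q),
    φ p (σ.reindex θ) = Form.pullback θ k (φ q σ)}
  add_mem' := fun ha hb p q θ σ => by simp [ha p q θ σ, hb p q θ σ]
  zero_mem' := fun p q θ σ => by simp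
  smul_mem' := fun c φ h p q θ σ => by simp [h p q θ σ]

/-- The differential `d : A^k(K) → A^{k+1}(K)`, `(dφ)_σ = d φ_σ`. -/
def Forms.d (K : AbstractSimplicialComplex V) (k : ℕ) : Forms K k →ₗ[ℝ] Forms K (k + 1) where
  toFun φ := ⟨fun q σ => Form.d q k (φ.1 q σ), fun p q θ σ => by
    change Form.d p k (φ.1 p (σ.reindex θ)) = Form.pullback θ (k + 1) (Form.d q k (φ.1 q σ))
    rw [φ.2 p q θ σ, Form.d_pullback]⟩
  map_add' φ ψ := by
    apply Subtype.ext
    funext q σ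
    simp
  map_smul' c φ := by
    apply Subtype.ext
    funext q σ
    simp

/-- The map `A^k(L) → A^k(K)` induced by a simplicial map `f : K → L`, `(f φ)_σ = φ_{f(σ)}`. -/
def SimplicialMap.pullForm {K : AbstractSimplicialComplex V} {L : AbstractSimplicialComplex W}
    (f : SimplicialMap K L) (k : ℕ) : Forms L k →ₗ[ℝ] Forms K k where
  toFun φ := ⟨fun q σ => φ.1 q (f.onSimplex σ), fun p q θ σ => φ.2 p q θ (f.onSimplex σ)⟩
  map_add' _ _ := rfl
  map_smul' _ _ := rfl

/-- `A^•(K) = ⨁_k A^k(K)`. -/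
abbrev AllForms (K : AbstractSimplicialComplex V) : Type u := ⨁ k : ℕ, Forms K k

/-- The map `A^•(L) → A^•(K)` induced by a simplicial map `f : K → L`. -/
def SimplicialMap.pullForms {K : AbstractSimplicialComplex V} {L : AbstractSimplicialComplex W}
    (f : SimplicialMap K L) : AllForms L →ₗ[ℝ] AllForms K :=
  DirectSum.lmap fun k => f.pullForm k

/-- `t ∈ A^•(K)` is closed and all its components have odd degree `≥ 3`, that is,
`t ∈ ⨁_{i ≥ 1} A^{2i+1}(K)` and `dt = 0`. -/
def IsTwist {K : AbstractSimplicialComplex V} (t : AllForms K) : Prop :=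
  (∀ k, ¬ (Odd k ∧ 3 ≤ k) → t k = 0) ∧ ∀ k, Forms.d K k (t k) = 0

/-! ## The Dupont complex -/

/-- `C_q(K)`: simplicial `q`-chains with real coefficients. -/
abbrev Chain (K : AbstractSimplicialComplex V) (q : ℕ) : Type u := OrdSimplex K q →₀ ℝ

/-- Indices of the summands of `Du_n`: the pairs `(q, j)` with `q = n + j`. -/
abbrev DuIndex (n : ℕ) : Type := {p : ℕ × ℕ // p.1 = n + p.2}

/-- The summand `A^j(Δ^q) ⊗ C_q(K)` of the Dupont complex. -/
def DuTerm (K : AbstractSimplicialComplex V) (q j : ℕ) : Type u := Form q j ⊗[ℝ] Chain K q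

instance (K : AbstractSimplicialComplex V) (q j : ℕ) : AddCommMonoid (DuTerm K q j) :=
  inferInstanceAs (AddCommMonoid (Form q j ⊗[ℝ] Chain K q))

instance (K : AbstractSimplicialComplex V) (q j : ℕ) : Module ℝ (DuTerm K q j) :=
  inferInstanceAs (Module ℝ (Form q j ⊗[ℝ] Chain K q))

/-- `Du_n(K) = ⨁_{j ≥ 0} A^j(Δ^{n+j}) ⊗ C_{n+j}(K)`. -/
abbrev Du (K : AbstractSimplicialComplex V) (n : ℕ) : Type u :=
  ⨁ p : DuIndex n, DuTerm K p.1.1 p.1.2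

/-- The linear map `ω ⊗ c ↦ a(ω) ⊗ b(c)` between summands. -/
def DuTerm.map {K : AbstractSimplicialComplex V} {L : AbstractSimplicialComplex W}
    {q j q' j' : ℕ} (a : Form q j →ₗ[ℝ] Form q' j') (b : Chain K q →ₗ[ℝ] Chain L q') :
    DuTerm K q j →ₗ[ℝ] DuTerm L q' j' :=
  TensorProduct.map a b

/-- The inclusion of the summand `A^j(Δ^q) ⊗ C_q(K)`, `q = n + j`, of `Du_n(K)`. -/
def Du.incl (K : AbstractSimplicialComplex V) {n : ℕ} (q j : ℕ) (h : q = n + j) :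
    DuTerm K q j →ₗ[ℝ] Du K n :=
  DirectSum.lof ℝ (DuIndex n) (fun p => DuTerm K p.1.1 p.1.2) ⟨(q, j), h⟩

/-- The restriction to `A^j(Δ^q) ⊗ C_q(K)`, `q = n + 1 + j`, of the differential of `Du(K)`. -/
def Du.boundaryAux (K : AbstractSimplicialComplex V) (n : ℕ) :
    (q j : ℕ) → q = n + 1 + j → (DuTerm K q j →ₗ[ℝ] Du K n)
  | 0, _, h => absurd h (by omega)
  | q + 1, j, h =>
    (-1 : ℝ) ^ (n + 1) • (Du.incl K (q + 1) (j + 1) (by omega) ∘ₗ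
        DuTerm.map (Form.d (q + 1) j) LinearMap.id) +
      ∑ i : Fin (q + 2), (-1 : ℝ) ^ (i : ℕ) • (Du.incl K q j (by omega) ∘ₗ
        DuTerm.map (Form.pullback i.succAbove j)
          (Finsupp.lmapDomain ℝ ℝ (OrdSimplex.face i)))

/-- The differential `∂ : Du_{n+1}(K) → Du_n(K)`, `n ≥ 0`, given by
`∂(ω ⊗ σ) = (-1)^{n+1} dω ⊗ σ + ∑_i (-1)^i (ε^i)^*(ω) ⊗ ε_i(σ)`. -/
def Du.boundary (K : AbstractSimplicialComplex V) (n : ℕ) : Du K (n + 1) →ₗ[ℝ] Du K n :=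
  DirectSum.toModule ℝ (DuIndex (n + 1)) (Du K n) fun p =>
    Du.boundaryAux K n p.1.1 p.1.2 p.2

/-- The chain map `f_• : Du_•(K) → Du_•(L)`, `ω ⊗ σ ↦ ω ⊗ f(σ)`, induced by a simplicial map
`f : K → L`. -/
def SimplicialMap.du {K : AbstractSimplicialComplex V} {L : AbstractSimplicialComplex W}
    (f : SimplicialMap K L) (n : ℕ) : Du K n →ₗ[ℝ] Du L n :=
  DirectSum.lmap fun _ => DuTerm.map LinearMap.id (Finsupp.lmapDomain ℝ ℝ f.onSimplex)

/-- The linear map `A^j(Δ^q) ⊗ C_q(K) → A^{k+j}(Δ^q) ⊗ C_q(K)`, `ω ⊗ σ ↦ (φ_σ ∧ ω) ⊗ σ`. -/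
def Du.mulAux {K : AbstractSimplicialComplex V} {k : ℕ} (φ : Forms K k) (q j : ℕ) :
    DuTerm K q j →ₗ[ℝ] DuTerm K q (k + j) :=
  TensorProduct.lift (LinearMap.flip (Finsupp.lift _ ℝ (OrdSimplex K q) fun σ =>
    (TensorProduct.mk ℝ (Form q (k + j)) (Chain K q)).flip (Finsupp.single σ 1) ∘ₗ
      Form.wedge q k j (φ.1 q σ)))

/-- The product `Du_{n+k}(K) → Du_n(K)`, `φ · (ω ⊗ σ) = (φ_σ ∧ ω) ⊗ σ`, by `φ ∈ A^k(K)`. -/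
def Du.mul {K : AbstractSimplicialComplex V} {k : ℕ} (φ : Forms K k) (n : ℕ) :
    Du K (n + k) →ₗ[ℝ] Du K n :=
  DirectSum.toModule ℝ (DuIndex (n + k)) (Du K n) fun p =>
    Du.incl K p.1.1 (k + p.1.2) (by have := p.2; omega) ∘ₗ Du.mulAux φ p.1.1 p.1.2

end Complexes

/-! ## Geometric realization and fundamental group -/

section Cover

variable {V W X : Type u}

/-- The geometric realization `|K|`: the points are the families of barycentric coordinates
`x_v ≥ 0`, with sum `1`, whose support is a simplex of `K`. -/
@[ext]
structure Realization (K : AbstractSimplicialComplex V) where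
  /-- the barycentric coordinates -/
  coord : V →₀ ℝ
  nonneg : ∀ v, 0 ≤ coord v
  sum_eq_one : (coord.sum fun _ a => a) = 1
  support_mem : coord.support ∈ K.faces

open scoped Classical in
theorem realization_aux (K : AbstractSimplicialComplex V) {q : ℕ} (σ : OrdSimplex K q)
    (x : stdSimplex ℝ (Fin (q + 1))) :
    (∀ v, 0 ≤ (∑ i, Finsupp.single (σ.vert i) (x.1 i)) v) ∧
      ((∑ i, Finsupp.single (σ.vert i) (x.1 i)).sum fun _ a => a) = 1 ∧
      (∑ i, Finsupp.single (σ.vert i) (x.1 i)).support ∈ K.faces := by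
  have hsum : ((∑ i, Finsupp.single (σ.vert i) (x.1 i)).sum fun _ a => a) = 1 := by
    rw [← Finsupp.sum_finsetSum_index (by simp) (by simp)]
    simpa using x.2.2
  refine ⟨fun v => ?_, hsum, subset_mem_faces K σ.mem_faces ?_ ?_⟩
  · rw [Finsupp.finsetSum_apply]
    refine Finset.sum_nonneg fun i _ => ?_
    rw [Finsupp.single_apply]
    split_ifs
    · exact x.2.1 i
    · exact le_rfl
  · intro v hv
    have h := Finsupp.support_finsetSum hv
    simp only [Finset.mem_biUnion, Finset.mem_univ, true_and] at h
    obtain ⟨i, hi⟩ := h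
    have := Finsupp.support_single_subset hi
    simp only [Finset.mem_singleton] at this
    exact Finset.mem_image.2 ⟨i, Finset.mem_univ _, this.symm⟩
  · rw [Finset.nonempty_iff_ne_empty, Ne, Finsupp.support_eq_empty]
    intro h0
    rw [h0] at hsum
    simp at hsum

/-- The characteristic map `Δ^q → |K|` of an ordered simplex `σ = (v_0, …, v_q)`, which maps the
`i`-th vertex to `v_i` and is affine. -/
def charMap (K : AbstractSimplicialComplex V) {q : ℕ} (σ : OrdSimplex K q)
    (x : stdSimplex ℝ (Fin (q + 1))) : Realization K :=
  ⟨∑ i, Finsupp.single (σ.vert i) (x.1 i), (realization_aux K σ x).1, (realization_aux K σ x).2.1,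
    (realization_aux K σ x).2.2⟩

/-- The weak topology on `|K|`, i.e. the finest one such that all the characteristic maps of
simplexes are continuous. -/
instance (K : AbstractSimplicialComplex V) : TopologicalSpace (Realization K) :=
  ⨆ (q : ℕ) (σ : OrdSimplex K q), TopologicalSpace.coinduced (charMap K σ) inferInstance

theorem continuous_charMap (K : AbstractSimplicialComplex V) {q : ℕ} (σ : OrdSimplex K q) :
    Continuous (charMap K σ) := by
  rw [continuous_iff_coinduced_le]
  exact le_iSup₂_of_le q σ le_rfl

open scoped Classical in
theorem mapDomain_aux {K : AbstractSimplicialComplex V} {L : AbstractSimplicialComplex W}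
    (f : SimplicialMap K L) (x : Realization K) :
    (∀ w, 0 ≤ x.coord.mapDomain f.toFun w) ∧
      ((x.coord.mapDomain f.toFun).sum fun _ a => a) = 1 ∧
      (x.coord.mapDomain f.toFun).support ∈ L.faces := by
  have hsum : ((x.coord.mapDomain f.toFun).sum fun _ a => a) = 1 := by
    rw [Finsupp.sum_mapDomain_index (by simp) (by simp)]
    exact x.sum_eq_one
  refine ⟨fun w => ?_, hsum, subset_mem_faces L (f.map_faces _ x.support_mem)
    Finsupp.mapDomain_support ?_⟩
  · rw [Finsupp.mapDomain, Finsupp.sum_apply]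
    refine Finset.sum_nonneg fun v _ => ?_
    simp only [Finsupp.single_apply]
    split_ifs
    · exact x.nonneg v
    · exact le_rfl
  · rw [Finset.nonempty_iff_ne_empty, Ne, Finsupp.support_eq_empty]
    intro h0
    rw [h0] at hsum
    simp at hsum

/-- The map `|K| → |L|` induced by a simplicial map `f : K → L`. -/
def SimplicialMap.realizeFun {K : AbstractSimplicialComplex V} {L : AbstractSimplicialComplex W}
    (f : SimplicialMap K L) (x : Realization K) : Realization L :=
  ⟨x.coord.mapDomain f.toFun, (mapDomain_aux f x).1, (mapDomain_aux f x).2.1,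
    (mapDomain_aux f x).2.2⟩

theorem SimplicialMap.realizeFun_charMap {K : AbstractSimplicialComplex V}
    {L : AbstractSimplicialComplex W} (f : SimplicialMap K L) {q : ℕ} (σ : OrdSimplex K q)
    (x : stdSimplex ℝ (Fin (q + 1))) :
    f.realizeFun (charMap K σ x) = charMap L (f.onSimplex σ) x := by
  apply Realization.ext
  simp [charMap, SimplicialMap.onSimplex, SimplicialMap.realizeFun, Finsupp.mapDomain_finsetSum]

/-- The continuous map `|f| : |K| → |L|` induced by a simplicial map `f : K → L`. -/
def SimplicialMap.realize {K : AbstractSimplicialComplex V} {L : AbstractSimplicialComplex W}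
    (f : SimplicialMap K L) : C(Realization K, Realization L) where
  toFun := f.realizeFun
  continuous_toFun := by
    refine continuous_iSup_dom.2 fun q => continuous_iSup_dom.2 fun σ =>
      continuous_coinduced_dom.2 ?_
    convert! continuous_charMap L (f.onSimplex σ) using 1
    funext x
    exact f.realizeFun_charMap σ x

/-- The point of `|K|` which is given by a vertex of `K`. -/
def vertexPt (K : AbstractSimplicialComplex V) (v : V) : Realization K where
  coord := Finsupp.single v 1
  nonneg w := by
    classical
    rw [Finsupp.single_apply]
    split_ifs <;> norm_num
  sum_eq_one := by simp
  support_mem := by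
    rw [Finsupp.support_single v one_ne_zero]
    exact K.singleton_mem v

theorem SimplicialMap.realize_vertexPt {K : AbstractSimplicialComplex V}
    {L : AbstractSimplicialComplex W} (f : SimplicialMap K L) (v : V) :
    f.realize (vertexPt K v) = vertexPt L (f.toFun v) := by
  change f.realizeFun (vertexPt K v) = _
  apply Realization.ext
  simp [SimplicialMap.realizeFun, vertexPt]

/-- `π_1(K)`, with a vertex `k₀` as base point. -/
abbrev PiOne (K : AbstractSimplicialComplex V) (k₀ : V) : Type u :=
  FundamentalGroup (Realization K) (vertexPt K k₀)

/-- The homomorphism `f_* : π_1(K, k₀) → π_1(L, f(k₀))` induced by a simplicial map. -/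
def SimplicialMap.piOne {K : AbstractSimplicialComplex V} {L : AbstractSimplicialComplex W}
    (f : SimplicialMap K L) (k₀ : V) : PiOne K k₀ →* PiOne L (f.toFun k₀) :=
  FundamentalGroup.mapOfEq f.realize (f.realize_vertexPt k₀)

/-! ## The universal covering -/

open scoped Classical in
/-- `v` and `w` span a simplex (of dimension zero or one) of `K`. -/
def Spans (K : AbstractSimplicialComplex V) (v w : V) : Prop := ({v, w} : Finset V) ∈ K.faces

open scoped Classical in
/-- The ordered simplex `(v, w)`. -/
def edgeSimplex (K : AbstractSimplicialComplex V) {v w : V} (h : Spans K v w) : OrdSimplex K 1 where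
  vert := ![v, w]
  mem_faces := by
    have : Finset.univ.image ![v, w] = {v, w} := by
      ext x
      simp [eq_comm]
    rw [this]
    exact h

/-- The point of `Δ^1` with barycentric coordinates `(1 - t, t)`. -/
def edgePt (t : unitInterval) : stdSimplex ℝ (Fin 2) :=
  ⟨![1 - (t : ℝ), (t : ℝ)], fun i => by
    refine Fin.cases ?_ (fun j => ?_) i
    · simpa using t.2.2
    · simpa using t.2.1, by simp⟩

theorem continuous_edgePt : Continuous edgePt := by
  refine Continuous.subtype_mk (continuous_pi fun i => ?_) _
  refine Fin.cases ?_ (fun j => ?_) i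
  · simp only [Matrix.cons_val_zero]
    fun_prop
  · simp only [Matrix.cons_val_succ, Matrix.cons_val_fin_one]
    fun_prop

theorem charMap_edgePt_coord (K : AbstractSimplicialComplex V) {v w : V} (h : Spans K v w)
    (t : unitInterval) : (charMap K (edgeSimplex K h) (edgePt t)).coord =
      Finsupp.single v (1 - (t : ℝ)) + Finsupp.single w (t : ℝ) := by
  simp [charMap, edgeSimplex, edgePt, Fin.sum_univ_two, -Finsupp.single_sub]

/-- The straight path in `|K|` from the vertex `v` to the vertex `w`. -/
def edgePath (K : AbstractSimplicialComplex V) {v w : V} (h : Spans K v w) :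
    Path (vertexPt K v) (vertexPt K w) where
  toFun t := charMap K (edgeSimplex K h) (edgePt t)
  continuous_toFun := (continuous_charMap K _).comp continuous_edgePt
  source' := by
    apply Realization.ext
    rw [charMap_edgePt_coord]
    simp [vertexPt]
  target' := by
    apply Realization.ext
    rw [charMap_edgePt_coord]
    simp [vertexPt]

/-- The homotopy class, with fixed end points, of the straight path from `v` to `w`. -/
def edgeClass (K : AbstractSimplicialComplex V) {v w : V} (h : Spans K v w) :
    Path.Homotopic.Quotient (vertexPt K v) (vertexPt K w) :=
  Path.Homotopic.Quotient.mk (edgePath K h)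

theorem spans_self (K : AbstractSimplicialComplex V) (v : V) : Spans K v v := by
  simpa [Spans] using K.singleton_mem v

theorem edgeClass_self (K : AbstractSimplicialComplex V) {v : V} (h : Spans K v v) :
    edgeClass K h = Path.Homotopic.Quotient.refl (vertexPt K v) := by
  have : edgePath K h = Path.refl (vertexPt K v) := by
    ext1
    funext t
    change charMap K (edgeSimplex K h) (edgePt t) = vertexPt K v
    apply Realization.ext
    rw [charMap_edgePt_coord, ← Finsupp.single_add, sub_add_cancel]
    rfl
  rw [edgeClass, this]
  rfl

open scoped Classical in
theorem SimplicialMap.spans {K : AbstractSimplicialComplex V} {L : AbstractSimplicialComplex W}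
    (f : SimplicialMap K L) {v w : V} (h : Spans K v w) : Spans L (f.toFun v) (f.toFun w) := by
  have := f.map_faces _ h
  simpa [Spans, Finset.image_insert] using this

/-- The map induced by `f` on homotopy classes of paths between vertices. -/
def SimplicialMap.onPaths {K : AbstractSimplicialComplex V} {L : AbstractSimplicialComplex W}
    (f : SimplicialMap K L) {v w : V} (γ : Path.Homotopic.Quotient (vertexPt K v) (vertexPt K w)) :
    Path.Homotopic.Quotient (vertexPt L (f.toFun v)) (vertexPt L (f.toFun w)) :=
  (γ.map f.realize).cast (f.realize_vertexPt v).symm (f.realize_vertexPt w).symm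

theorem SimplicialMap.onPaths_edgeClass {K : AbstractSimplicialComplex V}
    {L : AbstractSimplicialComplex W} (f : SimplicialMap K L) {v w : V} (h : Spans K v w) :
    f.onPaths (edgeClass K h) = edgeClass L (f.spans h) := by
  change Path.Homotopic.Quotient.mk (((edgePath K h).map f.realize.continuous).cast
    (f.realize_vertexPt v).symm (f.realize_vertexPt w).symm) = _
  rw [edgeClass]
  congr 1
  ext1
  funext t
  change f.realizeFun (charMap K (edgeSimplex K h) (edgePt t)) =
    charMap L (edgeSimplex L (f.spans h)) (edgePt t)
  apply Realization.ext
  rw [charMap_edgePt_coord]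
  change Finsupp.mapDomain f.toFun (charMap K (edgeSimplex K h) (edgePt t)).coord = _
  rw [charMap_edgePt_coord, Finsupp.mapDomain_add, Finsupp.mapDomain_single,
    Finsupp.mapDomain_single]

theorem SimplicialMap.onPaths_trans {K : AbstractSimplicialComplex V}
    {L : AbstractSimplicialComplex W} (f : SimplicialMap K L) {v w x : V}
    (γ : Path.Homotopic.Quotient (vertexPt K v) (vertexPt K w))
    (δ : Path.Homotopic.Quotient (vertexPt K w) (vertexPt K x)) :
    f.onPaths (γ.trans δ) = (f.onPaths γ).trans (f.onPaths δ) := by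
  induction γ with | _ γ
  induction δ with | _ δ
  change Path.Homotopic.Quotient.mk _ = Path.Homotopic.Quotient.mk _
  congr 1
  ext t
  simp [Path.trans_apply]

theorem quotient_trans_refl {Y : Type u} [TopologicalSpace Y] {x y : Y}
    (γ : Path.Homotopic.Quotient x y) : γ.trans (Path.Homotopic.Quotient.refl y) = γ := by
  induction γ with | _ γ
  exact Quotient.sound ⟨Path.Homotopy.transRefl γ⟩

theorem quotient_trans_assoc {Y : Type u} [TopologicalSpace Y] {x y z w : Y}
    (γ : Path.Homotopic.Quotient x y) (δ : Path.Homotopic.Quotient y z)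
    (ε : Path.Homotopic.Quotient z w) : (γ.trans δ).trans ε = γ.trans (δ.trans ε) := by
  induction γ with | _ γ
  induction δ with | _ δ
  induction ε with | _ ε
  exact Quotient.sound ⟨Path.Homotopy.transAssoc γ δ ε⟩

/-- The vertices of the universal covering `K̃` of `(K, k₀)`: the pairs of a vertex `v` of `K` and
the homotopy class of a path from `k₀` to `v` in `|K|`. -/
structure CoverVertex (K : AbstractSimplicialComplex V) (k₀ : V) where
  /-- the image `v` in `K` -/
  vert : V
  /-- the homotopy class of a path from `k₀` to `v` -/
  path : Path.Homotopic.Quotient (vertexPt K k₀) (vertexPt K vert)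

open scoped Classical in
/-- The universal covering `K̃` of `(K, k₀)` with its induced simplicial structure: a set of
vertices `(v, γ)` is a simplex if the `v` span a simplex of `K` and the classes `γ` correspond to
each other under the straight paths in that simplex. -/
def cover (K : AbstractSimplicialComplex V) (k₀ : V) :
    AbstractSimplicialComplex (CoverVertex K k₀) where
  faces := {s | s.image CoverVertex.vert ∈ K.faces ∧
    ∀ a ∈ s, ∀ b ∈ s, ∃ h : Spans K a.vert b.vert, a.path.trans (edgeClass K h) = b.path}
  isRelLowerSet_faces := fun s hs => by
    refine ⟨?_, fun t hts ht => ⟨subset_mem_faces K hs.1 (Finset.image_subset_image hts)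
      (ht.image _), fun a ha b hb => hs.2 a (hts ha) b (hts hb)⟩⟩
    exact Finset.image_nonempty.1 (K.isRelLowerSet_faces hs.1).1
  singleton_mem := fun a => by
    refine ⟨by simpa using K.singleton_mem a.vert, fun b hb c hc => ?_⟩
    rw [Finset.mem_singleton] at hb hc
    subst hb hc
    refine ⟨spans_self K _, ?_⟩
    rw [edgeClass_self]
    exact quotient_trans_refl _

open scoped Classical in
/-- The covering transformation `x ↦ x · g` of `K̃` given by `g ∈ π_1(K, k₀)`:
`(v, γ) · g = (v, g γ)` (the loop `g` followed by `γ`). As the product `g h` in the fundamental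
group of Mathlib is the loop `h` followed by the loop `g`, this is a right action. -/
def deck (K : AbstractSimplicialComplex V) (k₀ : V) (g : PiOne K k₀) :
    SimplicialMap (cover K k₀) (cover K k₀) where
  toFun a := ⟨a.vert, Path.Homotopic.Quotient.trans g a.path⟩
  map_faces s hs := by
    refine ⟨?_, fun a ha b hb => ?_⟩
    · rw [Finset.image_image]
      exact hs.1
    · simp only [Finset.mem_image] at ha hb
      obtain ⟨a, ha, rfl⟩ := ha
      obtain ⟨b, hb, rfl⟩ := hb
      obtain ⟨h, e⟩ := hs.2 a ha b hb
      refine ⟨h, ?_⟩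
      rw [← e]
      exact quotient_trans_assoc _ _ _

open scoped Classical in
/-- The lift `f̃ : K̃ → L̃` of a simplicial map `f : (K, k₀) → (L, f(k₀))`. -/
def SimplicialMap.lift {K : AbstractSimplicialComplex V} {L : AbstractSimplicialComplex W}
    (f : SimplicialMap K L) (k₀ : V) :
    SimplicialMap (cover K k₀) (cover L (f.toFun k₀)) where
  toFun a := ⟨f.toFun a.vert, f.onPaths a.path⟩
  map_faces s hs := by
    refine ⟨?_, fun a ha b hb => ?_⟩
    · have := f.map_faces _ hs.1
      rw [Finset.image_image] at this ⊢
      exact this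
    · simp only [Finset.mem_image] at ha hb
      obtain ⟨a, ha, rfl⟩ := ha
      obtain ⟨b, hb, rfl⟩ := hb
      obtain ⟨h, e⟩ := hs.2 a ha b hb
      refine ⟨f.spans h, ?_⟩
      rw [← e, f.onPaths_trans, f.onPaths_edgeClass]

theorem SimplicialMap.lift_deck {K : AbstractSimplicialComplex V}
    {L : AbstractSimplicialComplex W} (f : SimplicialMap K L) (k₀ : V) (g : PiOne K k₀) :
    (f.lift k₀).comp (deck K k₀ g) = (deck L (f.toFun k₀) (f.piOne k₀ g)).comp (f.lift k₀) := by
  apply SimplicialMap.ext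
  funext a
  change CoverVertex.mk (f.toFun a.vert) (f.onPaths (Path.Homotopic.Quotient.trans g a.path)) =
    CoverVertex.mk (f.toFun a.vert)
      (Path.Homotopic.Quotient.trans (f.piOne k₀ g) (f.onPaths a.path))
  rw [f.onPaths_trans, SimplicialMap.piOne, FundamentalGroup.mapOfEq_apply]
  rfl

end Cover

/-! ## Naturality of the operations on the Dupont complex -/

section Naturality

variable {V W X : Type u} {K : AbstractSimplicialComplex V} {L : AbstractSimplicialComplex W}

theorem SimplicialMap.du_incl (f : SimplicialMap K L) {n : ℕ} (q j : ℕ) (h : q = n + j)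
    (x : DuTerm K q j) : f.du n (Du.incl K q j h x) =
      Du.incl L q j h (DuTerm.map LinearMap.id (Finsupp.lmapDomain ℝ ℝ f.onSimplex) x) := by
  unfold SimplicialMap.du Du.incl
  rw [DirectSum.lmap_lof]

theorem Du.boundary_incl {n : ℕ} (q j : ℕ) (h : q = n + 1 + j) (x : DuTerm K q j) :
    Du.boundary K n (Du.incl K q j h x) = Du.boundaryAux K n q j h x := by
  unfold Du.boundary Du.incl
  rw [DirectSum.toModule_lof]

theorem Du.mul_incl {k : ℕ} (φ : Forms K k) {n : ℕ} (q j : ℕ) (h : q = n + k + j)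
    (x : DuTerm K q j) : Du.mul φ n (Du.incl K q j h x) =
      Du.incl K q (k + j) (by omega) (Du.mulAux φ q j x) := by
  unfold Du.mul Du.incl
  rw [DirectSum.toModule_lof]
  rfl

/-- The element `ω ⊗ σ` of the Dupont complex. -/
def DuTerm.tmul {q j : ℕ} (w : Form q j) (σ : OrdSimplex K q) : DuTerm K q j :=
  w ⊗ₜ[ℝ] Finsupp.single σ 1

theorem DuTerm.map_tmul {q j q' j' : ℕ} (a : Form q j →ₗ[ℝ] Form q' j')
    (b : OrdSimplex K q → OrdSimplex L q') (w : Form q j) (σ : OrdSimplex K q) :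
    DuTerm.map a (Finsupp.lmapDomain ℝ ℝ b) (DuTerm.tmul w σ) = DuTerm.tmul (a w) (b σ) := by
  change TensorProduct.map a (Finsupp.lmapDomain ℝ ℝ b) (w ⊗ₜ[ℝ] Finsupp.single σ 1) = _
  rw [TensorProduct.map_tmul, Finsupp.lmapDomain_apply, Finsupp.mapDomain_single]
  rfl

theorem DuTerm.map_id_tmul {q j q' : ℕ} (a : Form q j →ₗ[ℝ] Form q q') (w : Form q j)
    (σ : OrdSimplex K q) :
    DuTerm.map (L := K) a LinearMap.id (DuTerm.tmul w σ) = DuTerm.tmul (a w) σ :=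
  rfl

theorem Du.mulAux_tmul {k : ℕ} (φ : Forms K k) (q j : ℕ) (w : Form q j) (σ : OrdSimplex K q) :
    Du.mulAux φ q j (DuTerm.tmul w σ) = DuTerm.tmul (Form.wedge q k j (φ.1 q σ) w) σ := by
  change TensorProduct.lift _ (w ⊗ₜ[ℝ] Finsupp.single σ 1) = _
  rw [TensorProduct.lift.tmul]
  simp
  rfl

theorem Du.ext {M : Type v} [AddCommMonoid M] [Module ℝ M] {n : ℕ} {a b : Du K n →ₗ[ℝ] M}
    (h : ∀ (q j : ℕ) (hq : q = n + j) (w : Form q j) (σ : OrdSimplex K q),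
      a (Du.incl K q j hq (DuTerm.tmul w σ)) = b (Du.incl K q j hq (DuTerm.tmul w σ))) : a = b := by
  refine DirectSum.linearMap_ext ℝ fun p => ?_
  obtain ⟨⟨q, j⟩, hq⟩ := p
  refine LinearMap.ext fun x => ?_
  change a (Du.incl K q j hq x) = b (Du.incl K q j hq x)
  have hadd : ∀ x y : DuTerm K q j, a (Du.incl K q j hq x) = b (Du.incl K q j hq x) →
      a (Du.incl K q j hq y) = b (Du.incl K q j hq y) →
      a (Du.incl K q j hq (x + y)) = b (Du.incl K q j hq (x + y)) := fun x y hx hy => by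
    rw [map_add, map_add, map_add, hx, hy]
  refine TensorProduct.induction_on (motive := fun x : Form q j ⊗[ℝ] Chain K q =>
    a (Du.incl K q j hq x) = b (Du.incl K q j hq x)) x ?_ (fun w c => ?_) (fun x y hx hy => ?_)
  · change a (Du.incl K q j hq (0 : DuTerm K q j)) = b (Du.incl K q j hq (0 : DuTerm K q j))
    simp only [map_zero]
  · induction c using Finsupp.induction_linear with
    | zero =>
      rw [TensorProduct.tmul_zero]
      change a (Du.incl K q j hq (0 : DuTerm K q j)) = b (Du.incl K q j hq (0 : DuTerm K q j))
      simp only [map_zero]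
    | add c d hc hd =>
      rw [TensorProduct.tmul_add]
      exact hadd _ _ hc hd
    | single σ r =>
      have e : w ⊗ₜ[ℝ] Finsupp.single σ r = (r • w) ⊗ₜ[ℝ] Finsupp.single σ (1 : ℝ) := by
        rw [TensorProduct.smul_tmul, Finsupp.smul_single, smul_eq_mul, mul_one]
      rw [e]
      exact h q j hq (r • w) σ
  · exact hadd _ _ hx hy

theorem SimplicialMap.onSimplex_face (f : SimplicialMap K L) {q : ℕ} (i : Fin (q + 2))
    (σ : OrdSimplex K (q + 1)) :
    f.onSimplex (OrdSimplex.face i σ) = OrdSimplex.face i (f.onSimplex σ) :=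
  rfl

/-- `f_•` is a chain map. -/
theorem SimplicialMap.du_boundary (f : SimplicialMap K L) (n : ℕ) (x : Du K (n + 1)) :
    f.du n (Du.boundary K n x) = Du.boundary L n (f.du (n + 1) x) := by
  refine LinearMap.congr_fun (f := f.du n ∘ₗ Du.boundary K n)
    (g := Du.boundary L n ∘ₗ f.du (n + 1)) (Du.ext fun q j hq w σ => ?_) x
  simp only [LinearMap.comp_apply, f.du_incl, Du.boundary_incl, DuTerm.map_tmul]
  cases q with
  | zero => omega
  | succ q =>
    simp only [Du.boundaryAux, LinearMap.add_apply, LinearMap.smul_apply, LinearMap.sum_apply,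
      LinearMap.comp_apply, map_add, map_smul, map_sum, f.du_incl, DuTerm.map_tmul,
      DuTerm.map_id_tmul, LinearMap.id_apply, f.onSimplex_face]

/-- `f_•(f(φ) · x) = φ · f_•(x)`. -/
theorem SimplicialMap.du_mul (f : SimplicialMap K L) {k : ℕ} (φ : Forms L k) (n : ℕ)
    (x : Du K (n + k)) :
    f.du n (Du.mul (f.pullForm k φ) n x) = Du.mul φ n (f.du (n + k) x) := by
  refine LinearMap.congr_fun (f := f.du n ∘ₗ Du.mul (f.pullForm k φ) n)
    (g := Du.mul φ n ∘ₗ f.du (n + k)) (Du.ext fun q j hq w σ => ?_) x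
  simp only [LinearMap.comp_apply, f.du_incl, Du.mul_incl, DuTerm.map_tmul, Du.mulAux_tmul,
    LinearMap.id_apply]
  rfl

theorem SimplicialMap.du_comp {J : AbstractSimplicialComplex X} (f : SimplicialMap K L)
    (g : SimplicialMap J K) (n : ℕ) (x : Du J n) :
    (f.comp g).du n x = f.du n (g.du n x) := by
  refine LinearMap.congr_fun (f := (f.comp g).du n) (g := f.du n ∘ₗ g.du n)
    (Du.ext fun q j hq w σ => ?_) x
  simp only [LinearMap.comp_apply, SimplicialMap.du_incl, DuTerm.map_tmul, LinearMap.id_apply]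
  rfl

end Naturality

/-! ## Twisted cohomology -/

section Cohomology

variable {V W X : Type u}

/-- The projection `π : K̃ → K`. -/
def coverProj (K : AbstractSimplicialComplex V) (k₀ : V) : SimplicialMap (cover K k₀) K where
  toFun a := a.vert
  map_faces _ hs := hs.1

variable {𝕜 : Type w} [RCLike 𝕜] {E : Type v} [AddCommGroup E] [Module 𝕜 E] [Module ℝ E]
  [IsScalarTower ℝ 𝕜 E]

/-- `𝔪^n(K, E) = Hom_{ℝ[π_1(K)]}(Du_n(K̃), E)`. The group `π_1(K)` acts on `Du_n(K̃)` on the right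
through covering transformations, and on `E` on the left through `ρ`, so equivariance means
`α(x · g) = ρ(g)⁻¹ α(x)`. -/
def equivariantMaps (K : AbstractSimplicialComplex V) (k₀ : V)
    (ρ : Representation 𝕜 (PiOne K k₀) E) (n : ℕ) : Submodule 𝕜 (Du (cover K k₀) n →ₗ[ℝ] E) where
  carrier := {α | ∀ (g : PiOne K k₀) (x : Du (cover K k₀) n),
    α ((deck K k₀ g).du n x) = ρ g⁻¹ (α x)}
  add_mem' := fun ha hb g x => by simp [ha g x, hb g x]
  zero_mem' := fun g x => by simp
  smul_mem' := fun c α h g x => by simp [h g x]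

/-- The vector space `𝔪^n(K, E)` as a type. -/
def Cochain (K : AbstractSimplicialComplex V) (k₀ : V) (ρ : Representation 𝕜 (PiOne K k₀) E)
    (n : ℕ) : Type (max u v) :=
  equivariantMaps K k₀ ρ n

instance (K : AbstractSimplicialComplex V) (k₀ : V) (ρ : Representation 𝕜 (PiOne K k₀) E)
    (n : ℕ) : AddCommGroup (Cochain K k₀ ρ n) :=
  inferInstanceAs (AddCommGroup (equivariantMaps K k₀ ρ n))

instance (K : AbstractSimplicialComplex V) (k₀ : V) (ρ : Representation 𝕜 (PiOne K k₀) E)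
    (n : ℕ) : Module 𝕜 (Cochain K k₀ ρ n) :=
  inferInstanceAs (Module 𝕜 (equivariantMaps K k₀ ρ n))

/-- The differential `∂ : 𝔪^n(K, E) → 𝔪^{n+1}(K, E)`, `(∂α)(x) = α(∂x)`. -/
def Cochain.d (K : AbstractSimplicialComplex V) (k₀ : V) (ρ : Representation 𝕜 (PiOne K k₀) E)
    (n : ℕ) : Cochain K k₀ ρ n →ₗ[𝕜] Cochain K k₀ ρ (n + 1) where
  toFun α := ⟨α.1 ∘ₗ Du.boundary (cover K k₀) n, fun g x => by
    rw [LinearMap.comp_apply, ← SimplicialMap.du_boundary, α.2, LinearMap.comp_apply]⟩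
  map_add' _ _ := rfl
  map_smul' _ _ := rfl

/-- The structure of module over `A^•(K)`: the map `𝔪^n(K, E) → 𝔪^{n+k}(K, E)` given by
`φ ∈ A^k(K)` is `(φ · α)(x) = (-1)^{kn} α(φ · x)`, where `φ` acts on `Du(K̃)` through its pull-back
to `K̃`. -/
def Cochain.act {K : AbstractSimplicialComplex V} (k₀ : V) (ρ : Representation 𝕜 (PiOne K k₀) E)
    (n k : ℕ) (φ : Forms K k) : Cochain K k₀ ρ n →ₗ[𝕜] Cochain K k₀ ρ (n + k) where
  toFun α := ⟨(-1 : 𝕜) ^ (k * n) • (α.1 ∘ₗ Du.mul ((coverProj K k₀).pullForm k φ) n),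
    fun g x => by
      rw [LinearMap.smul_apply, LinearMap.smul_apply, LinearMap.comp_apply, LinearMap.comp_apply,
        map_smul, ← α.2]
      exact congrArg (fun y => (-1 : 𝕜) ^ (k * n) • α.1 y)
        ((deck K k₀ g).du_mul ((coverProj K k₀).pullForm k φ) n x).symm⟩
  map_add' α β := Subtype.ext (smul_add _ (α.1 ∘ₗ _) (β.1 ∘ₗ _))
  map_smul' c α := Subtype.ext (smul_comm _ c (α.1 ∘ₗ _))

/-- `𝔪^•(K, E) = ⨁_n 𝔪^n(K, E)`. -/
abbrev AllCochains (K : AbstractSimplicialComplex V) (k₀ : V)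
    (ρ : Representation 𝕜 (PiOne K k₀) E) :=
  ⨁ n : ℕ, Cochain K k₀ ρ n

open scoped Classical in
/-- The twisted differential `∂_t = ∂ + t·` on `𝔪^•(K, E)`. -/
def twistedD (K : AbstractSimplicialComplex V) (k₀ : V) (ρ : Representation 𝕜 (PiOne K k₀) E)
    (t : AllForms K) : AllCochains K k₀ ρ →ₗ[𝕜] AllCochains K k₀ ρ :=
  (DirectSum.toModule 𝕜 ℕ _ fun n =>
      DirectSum.lof 𝕜 ℕ (fun n => Cochain K k₀ ρ n) (n + 1) ∘ₗ Cochain.d K k₀ ρ n) +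
    DirectSum.toModule 𝕜 ℕ _ fun n =>
      DFinsupp.sum t fun k φ =>
        DirectSum.lof 𝕜 ℕ (fun n => Cochain K k₀ ρ n) (n + k) ∘ₗ Cochain.act k₀ ρ n k φ

/-- `𝔪^{ev}(K, E) = ⨁_{n even} 𝔪^n(K, E)` for `p = 0`, `𝔪^{od}(K, E) = ⨁_{n odd} 𝔪^n(K, E)` for
`p = 1`. -/
def ParityCochains (K : AbstractSimplicialComplex V) (k₀ : V)
    (ρ : Representation 𝕜 (PiOne K k₀) E) (p : ZMod 2) : Submodule 𝕜 (AllCochains K k₀ ρ) where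
  carrier := {α | ∀ n : ℕ, (n : ZMod 2) ≠ p → α n = 0}
  add_mem' := fun ha hb n hn => by rw [DirectSum.add_apply, ha n hn, hb n hn, add_zero]
  zero_mem' := fun n _ => rfl
  smul_mem' := fun c α h n hn => by rw [DirectSum.smul_apply, h n hn, smul_zero]

/-- The cocycles of parity `p` of the `ℤ/2`-graded complex `(𝔪^•(K, E), ∂_t)`. -/
def Cocycles (K : AbstractSimplicialComplex V) (k₀ : V) (ρ : Representation 𝕜 (PiOne K k₀) E)
    (t : AllForms K) (p : ZMod 2) : Submodule 𝕜 (AllCochains K k₀ ρ) :=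
  ParityCochains K k₀ ρ p ⊓ LinearMap.ker (twistedD K k₀ ρ t)

/-- The coboundaries of parity `p` of the `ℤ/2`-graded complex `(𝔪^•(K, E), ∂_t)`. -/
def Coboundaries (K : AbstractSimplicialComplex V) (k₀ : V)
    (ρ : Representation 𝕜 (PiOne K k₀) E) (t : AllForms K) (p : ZMod 2) :
    Submodule 𝕜 (AllCochains K k₀ ρ) :=
  (ParityCochains K k₀ ρ (p + 1)).map (twistedD K k₀ ρ t)

/-- The twisted simplicial cohomology: `H^{ev}(K, E, t)` for `p = 0` and `H^{od}(K, E, t)` for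
`p = 1`. -/
abbrev TwistedCoh (K : AbstractSimplicialComplex V) (k₀ : V)
    (ρ : Representation 𝕜 (PiOne K k₀) E) (t : AllForms K) (p : ZMod 2) :=
  Cocycles K k₀ ρ t p ⧸ (Coboundaries K k₀ ρ t p).submoduleOf (Cocycles K k₀ ρ t p)

/-- The class in `H^p(K, E, t)` of a cocycle. -/
def TwistedCoh.mk (K : AbstractSimplicialComplex V) (k₀ : V)
    (ρ : Representation 𝕜 (PiOne K k₀) E) (t : AllForms K) (p : ZMod 2)
    (α : AllCochains K k₀ ρ) (hα : α ∈ Cocycles K k₀ ρ t p) : TwistedCoh K k₀ ρ t p :=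
  Submodule.Quotient.mk ⟨α, hα⟩

/-- The identification `H^p(K, E, t) = H^p(K, E', t')` when the representations `E`, `E'` are
equal, and `t = t'`. -/
def TwistedCoh.congr {K : AbstractSimplicialComplex V} {k₀ : V}
    {ρ ρ' : Representation 𝕜 (PiOne K k₀) E} {t t' : AllForms K} (hρ : ρ = ρ') (ht : t = t')
    (p : ZMod 2) : TwistedCoh K k₀ ρ t p ≃ₗ[𝕜] TwistedCoh K k₀ ρ' t' p := by
  subst hρ
  subst ht
  exact LinearEquiv.refl 𝕜 _

/-- The representation `f^*E : π_1(K, k₀) → π_1(L, f(k₀)) → Aut(E)`. -/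
def SimplicialMap.pullRep {K : AbstractSimplicialComplex V} {L : AbstractSimplicialComplex W}
    (f : SimplicialMap K L) (k₀ : V) (ρ : Representation 𝕜 (PiOne L (f.toFun k₀)) E) :
    Representation 𝕜 (PiOne K k₀) E :=
  ρ.comp (f.piOne k₀)

/-- The map `𝔪^n(L, E) → 𝔪^n(K, f^*E)`, `α ↦ α ∘ f̃_•`, induced by a simplicial map `f : K → L`. -/
def SimplicialMap.pullCochain {K : AbstractSimplicialComplex V} {L : AbstractSimplicialComplex W}
    (f : SimplicialMap K L) (k₀ : V) (ρ : Representation 𝕜 (PiOne L (f.toFun k₀)) E) (n : ℕ) :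
    Cochain L (f.toFun k₀) ρ n →ₗ[𝕜] Cochain K k₀ (f.pullRep k₀ ρ) n where
  toFun α := ⟨α.1 ∘ₗ (f.lift k₀).du n, fun g x => by
    rw [LinearMap.comp_apply, ← SimplicialMap.du_comp, f.lift_deck, SimplicialMap.du_comp, α.2,
      ← map_inv]
    rfl⟩
  map_add' _ _ := rfl
  map_smul' _ _ := rfl

/-- The map `𝔪^•(L, E) → 𝔪^•(K, f^*E)` induced by a simplicial map `f : K → L`. -/
def SimplicialMap.pullCochains {K : AbstractSimplicialComplex V} {L : AbstractSimplicialComplex W}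
    (f : SimplicialMap K L) (k₀ : V) (ρ : Representation 𝕜 (PiOne L (f.toFun k₀)) E) :
    AllCochains L (f.toFun k₀) ρ →ₗ[𝕜] AllCochains K k₀ (f.pullRep k₀ ρ) :=
  DirectSum.lmap fun n => f.pullCochain k₀ ρ n

end Cohomology

end TwistedCohomology

end

open TwistedCohomology

universe u v w

/-! Everything is already natural at the level of the Dupont complex, so the work consists in
transporting naturality through three constructions: the universal covering, the twisted
differential, and the passage to cohomology.

Functoriality rests on path classes. Both $f_*$ on fundamental groups and the lift $\widetilde f$ on
vertices $(v,\gamma)$ are given by `onPaths`; once `onPaths` respects composition and identities, so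
do `piOne` and `lift`. This gives $(f\circ g)^*E=g^*f^*E$ and $\widetilde{f\circ g}=\widetilde
f\circ\widetilde g$. The equivariance of $\alpha\circ\widetilde f_\bullet$ under the representation
$f^*E$ is built into `pullCochain`.

For the existence of the induced map, $\alpha\mapsto\alpha\circ\widetilde f_\bullet$ must commute
with $\partial_t=\partial+t\cdot$ (`pullCochains_twistedD`). The summand $\partial$ is handled by
`du_boundary`, the summand $t\cdot$ by `du_mul` together with $\pi_L\circ\widetilde f=f\circ\pi_K$.
Since the map also preserves degrees, it preserves cocycles and coboundaries of each parity. The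
cohomology divides the cocycles by those of them that are coboundaries, so $\partial_t^2=0$ plays no
part in this argument.

The representations and twists in the functor laws agree as propositions, not by definition;
`congr_mk` reduces the comparison of classes to one of the underlying linear maps. -/

namespace TwistedCohomology

/-! ### Pull-back of piecewise smooth forms and of twists -/

section Forms

variable {V W X : Type u} {J : AbstractSimplicialComplex X} {K : AbstractSimplicialComplex V}
  {L : AbstractSimplicialComplex W}

theorem SimplicialMap.pullForms_apply (f : SimplicialMap K L) (t : AllForms L) (k : ℕ) :
    f.pullForms t k = f.pullForm k (t k) :=
  rfl

/-- The pull-back of forms commutes with the exterior derivative. -/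
theorem SimplicialMap.d_pullForm (f : SimplicialMap K L) (k : ℕ) (φ : Forms L k) :
    Forms.d K k (f.pullForm k φ) = f.pullForm (k + 1) (Forms.d L k φ) :=
  rfl

/-- In each degree both sides are the family $\sigma\mapsto t_{f(g(\sigma))}$, so the components
agree by definition; only extensionality of direct sums is needed. -/
theorem SimplicialMap.pullForms_comp (f : SimplicialMap K L) (g : SimplicialMap J K)
    (t : AllForms L) : (f.comp g).pullForms t = g.pullForms (f.pullForms t) :=
  DFinsupp.ext fun _ => rfl

theorem SimplicialMap.pullForms_id (t : AllForms K) : (SimplicialMap.id K).pullForms t = t :=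
  DFinsupp.ext fun _ => rfl

theorem IsTwist.pullForms {t : AllForms L} (ht : IsTwist t) (f : SimplicialMap K L) :
    IsTwist (f.pullForms t) := by
  refine ⟨fun k hk => ?_, fun k => ?_⟩
  · rw [f.pullForms_apply, ht.1 k hk, map_zero]
  · rw [f.pullForms_apply, f.d_pullForm, ht.2 k, map_zero]

end Forms

/-! ### Functoriality of path classes, fundamental groups and lifts to universal coverings -/

section Lifts

variable {V W X : Type u} {J : AbstractSimplicialComplex X} {K : AbstractSimplicialComplex V}
  {L : AbstractSimplicialComplex W}

theorem SimplicialMap.realizeFun_comp (f : SimplicialMap K L) (g : SimplicialMap J K)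
    (x : Realization J) : (f.comp g).realizeFun x = f.realizeFun (g.realizeFun x) :=
  Realization.ext (Finsupp.mapDomain_comp (f := g.toFun) (g := f.toFun))

theorem SimplicialMap.realizeFun_id (x : Realization K) :
    (SimplicialMap.id K).realizeFun x = x :=
  Realization.ext Finsupp.mapDomain_id

/-- This is the common source of the functoriality of `piOne` and of `lift`. The equality holds for
the paths themselves, without a homotopy: the end point casts in `onPaths` do not alter the
underlying function, and $|f\circ g|=|f|\circ|g|$ pointwise. -/
theorem SimplicialMap.onPaths_comp (f : SimplicialMap K L) (g : SimplicialMap J K) {v w : X}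
    (γ : Path.Homotopic.Quotient (vertexPt J v) (vertexPt J w)) :
    (f.comp g).onPaths γ = f.onPaths (g.onPaths γ) := by
  induction γ with | _ γ
  change Path.Homotopic.Quotient.mk _ = Path.Homotopic.Quotient.mk _
  congr 1
  ext1
  funext t
  exact f.realizeFun_comp g (γ t)

theorem SimplicialMap.onPaths_id {v w : V}
    (γ : Path.Homotopic.Quotient (vertexPt K v) (vertexPt K w)) :
    (SimplicialMap.id K).onPaths γ = γ := by
  induction γ with | _ γ
  change Path.Homotopic.Quotient.mk _ = Path.Homotopic.Quotient.mk _
  congr 1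
  ext1
  funext t
  exact SimplicialMap.realizeFun_id (γ t)

/-- Puts loops and paths between vertices on the same footing, so that statements about $f_*$ become
cases of those about `onPaths`. -/
theorem SimplicialMap.piOne_apply (f : SimplicialMap K L) (k₀ : V) (γ : PiOne K k₀) :
    f.piOne k₀ γ = f.onPaths γ := by
  rw [SimplicialMap.piOne, FundamentalGroup.mapOfEq_apply]
  rfl

theorem SimplicialMap.piOne_comp (f : SimplicialMap K L) (g : SimplicialMap J K) (j₀ : X) :
    (f.comp g).piOne j₀ = (f.piOne (g.toFun j₀)).comp (g.piOne j₀) := by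
  refine MonoidHom.ext fun γ => ?_
  change (f.comp g).piOne j₀ γ = f.piOne (g.toFun j₀) (g.piOne j₀ γ)
  -- The base points `(f.comp g).toFun j₀` and `f.toFun (g.toFun j₀)` agree only after unfolding
  -- `comp`; chaining terms lets the types match up to definitional equality.
  refine ((f.comp g).piOne_apply j₀ γ).trans ((f.onPaths_comp g γ).trans ?_)
  rw [f.piOne_apply, g.piOne_apply]

theorem SimplicialMap.piOne_id (k₀ : V) :
    (SimplicialMap.id K).piOne k₀ = MonoidHom.id (PiOne K k₀) := by
  ext γ
  rw [SimplicialMap.piOne_apply]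
  exact SimplicialMap.onPaths_id _

theorem SimplicialMap.lift_comp (f : SimplicialMap K L) (g : SimplicialMap J K) (j₀ : X) :
    (f.comp g).lift j₀ = (f.lift (g.toFun j₀)).comp (g.lift j₀) := by
  apply SimplicialMap.ext
  funext a
  -- The type of the path depends on the vertex, but the two vertices coincide definitionally, so
  -- fixing that entry leaves an ordinary equality of path classes.
  exact congrArg (CoverVertex.mk (f.toFun (g.toFun a.vert))) (f.onPaths_comp g a.path)

theorem SimplicialMap.lift_id (k₀ : V) :
    (SimplicialMap.id K).lift k₀ = SimplicialMap.id (cover K k₀) := by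
  apply SimplicialMap.ext
  funext a
  exact congrArg (CoverVertex.mk a.vert) (SimplicialMap.onPaths_id a.path)

theorem SimplicialMap.du_id (n : ℕ) (x : Du K n) : (SimplicialMap.id K).du n x = x := by
  refine LinearMap.congr_fun (f := (SimplicialMap.id K).du n) (g := LinearMap.id)
    (Du.ext fun q j hq w σ => ?_) x
  rw [SimplicialMap.du_incl, DuTerm.map_tmul]
  rfl

end Lifts

/-! ### Pulled back representations -/

section Cohomology

variable {V W X : Type u} {J : AbstractSimplicialComplex X} {K : AbstractSimplicialComplex V}
  {L : AbstractSimplicialComplex W}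
  {𝕜 : Type w} [RCLike 𝕜] {E : Type v} [AddCommGroup E] [Module 𝕜 E]

theorem SimplicialMap.pullRep_comp (f : SimplicialMap K L) (g : SimplicialMap J K) (j₀ : X)
    (ρ : Representation 𝕜 (PiOne L ((f.comp g).toFun j₀)) E) :
    (f.comp g).pullRep j₀ ρ = g.pullRep j₀ (f.pullRep (g.toFun j₀) ρ) := by
  unfold SimplicialMap.pullRep
  rw [f.piOne_comp g j₀]
  rfl

theorem SimplicialMap.pullRep_id (k₀ : V) (ρ : Representation 𝕜 (PiOne K k₀) E) :
    (SimplicialMap.id K).pullRep k₀ ρ = ρ := by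
  unfold SimplicialMap.pullRep
  rw [SimplicialMap.piOne_id k₀]
  rfl

/-! ### Compatibility of the cochain map with the twisted differential -/

variable [Module ℝ E] [IsScalarTower ℝ 𝕜 E]

theorem SimplicialMap.pullCochain_d (f : SimplicialMap K L) (k₀ : V)
    (ρ : Representation 𝕜 (PiOne L (f.toFun k₀)) E) (n : ℕ) (α : Cochain L (f.toFun k₀) ρ n) :
    f.pullCochain k₀ ρ (n + 1) (Cochain.d L (f.toFun k₀) ρ n α) =
      Cochain.d K k₀ (f.pullRep k₀ ρ) n (f.pullCochain k₀ ρ n α) :=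
  Subtype.ext (LinearMap.ext fun x => congrArg α.1 ((f.lift k₀).du_boundary n x).symm)

/-- A form on $L$ acts through its pull-back to $\widetilde L$, and $\pi_L\circ\widetilde
f=f\circ\pi_K$ holds by definition. Hence pulling $\pi_L^*\varphi$ back along $\widetilde f$ is the
same as pulling $f^*\varphi$ back along $\pi_K$, and `du_mul` for the lift applies. The sign depends
only on the degrees, which do not change. -/
theorem SimplicialMap.pullCochain_act (f : SimplicialMap K L) (k₀ : V)
    (ρ : Representation 𝕜 (PiOne L (f.toFun k₀)) E) (n k : ℕ) (φ : Forms L k)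
    (α : Cochain L (f.toFun k₀) ρ n) :
    f.pullCochain k₀ ρ (n + k) (Cochain.act (f.toFun k₀) ρ n k φ α) =
      Cochain.act k₀ (f.pullRep k₀ ρ) n k (f.pullForm k φ) (f.pullCochain k₀ ρ n α) :=
  Subtype.ext (LinearMap.ext fun x => congrArg (fun y => (-1 : 𝕜) ^ (k * n) • α.1 y)
    ((f.lift k₀).du_mul ((coverProj L (f.toFun k₀)).pullForm k φ) n x).symm)

/-- Needed because $f^*t$ can have fewer nonzero components than $t$: the terms that disappear from
the sum defining `twistedD` must contribute zero. As `act` is not bundled as a linear map in the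
form, this is checked on the generators $\omega\otimes\sigma$. -/
theorem Cochain.act_zero (k₀ : V) (ρ : Representation 𝕜 (PiOne K k₀) E) (n k : ℕ) :
    Cochain.act k₀ ρ n k (0 : Forms K k) = 0 := by
  have h : Du.mul (0 : Forms (cover K k₀) k) n = 0 := Du.ext fun q j hq w σ => by
    rw [Du.mul_incl, Du.mulAux_tmul]
    -- Exposes the tensor hidden behind `DuTerm`, and the value at $\sigma$ of the zero form as a
    -- literal zero.
    change Du.incl _ q (k + j) _ (Form.wedge q k j 0 w ⊗ₜ[ℝ] Finsupp.single σ 1) = 0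
    rw [map_zero, LinearMap.zero_apply, TensorProduct.zero_tmul]
    exact map_zero _
  refine LinearMap.ext fun α => Subtype.ext (LinearMap.ext fun x => ?_)
  change (-1 : 𝕜) ^ (k * n) • α.1 (Du.mul ((coverProj K k₀).pullForm k 0) n x) = 0
  rw [map_zero, h, LinearMap.zero_apply, map_zero, smul_zero]

-- `DFinsupp.sum` runs over the support of $t$ and so needs decidability of vanishing; the classical
-- instances are those used in the definition of `twistedD`.
open scoped Classical in
theorem twistedD_lof (k₀ : V) (ρ : Representation 𝕜 (PiOne K k₀) E) (t : AllForms K) (n : ℕ)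
    (α : Cochain K k₀ ρ n) :
    twistedD K k₀ ρ t (DirectSum.lof 𝕜 ℕ (fun n => Cochain K k₀ ρ n) n α) =
      DirectSum.lof 𝕜 ℕ (fun n => Cochain K k₀ ρ n) (n + 1) (Cochain.d K k₀ ρ n α) +
      DFinsupp.sum t fun k φ => DirectSum.lof 𝕜 ℕ (fun n => Cochain K k₀ ρ n) (n + k)
        (Cochain.act k₀ ρ n k φ α) := by
  unfold twistedD
  rw [LinearMap.add_apply, DirectSum.toModule_lof, DirectSum.toModule_lof]
  unfold DFinsupp.sum
  rw [LinearMap.sum_apply]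
  rfl

theorem SimplicialMap.pullCochains_lof (f : SimplicialMap K L) (k₀ : V)
    (ρ : Representation 𝕜 (PiOne L (f.toFun k₀)) E) (n : ℕ) (α : Cochain L (f.toFun k₀) ρ n) :
    f.pullCochains k₀ ρ
        (DirectSum.lof 𝕜 ℕ (fun n => Cochain L (f.toFun k₀) ρ n) n α) =
      DirectSum.lof 𝕜 ℕ (fun n => Cochain K k₀ (f.pullRep k₀ ρ) n) n
        (f.pullCochain k₀ ρ n α) := by
  unfold SimplicialMap.pullCochains
  rw [DirectSum.lmap_lof]

theorem SimplicialMap.pullCochains_apply (f : SimplicialMap K L) (k₀ : V)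
    (ρ : Representation 𝕜 (PiOne L (f.toFun k₀)) E) (α : AllCochains L (f.toFun k₀) ρ) (n : ℕ) :
    f.pullCochains k₀ ρ α n = f.pullCochain k₀ ρ n (α n) :=
  rfl

/-- The map induced by `f` on cochains commutes with the twisted differentials. -/
theorem SimplicialMap.pullCochains_twistedD (f : SimplicialMap K L) (k₀ : V)
    (ρ : Representation 𝕜 (PiOne L (f.toFun k₀)) E) (t : AllForms L)
    (α : AllCochains L (f.toFun k₀) ρ) :
    f.pullCochains k₀ ρ (twistedD L (f.toFun k₀) ρ t α) =
      twistedD K k₀ (f.pullRep k₀ ρ) (f.pullForms t) (f.pullCochains k₀ ρ α) := by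
  classical
  refine LinearMap.congr_fun (f := f.pullCochains k₀ ρ ∘ₗ twistedD L (f.toFun k₀) ρ t)
    (g := twistedD K k₀ (f.pullRep k₀ ρ) (f.pullForms t) ∘ₗ f.pullCochains k₀ ρ)
    (DirectSum.linearMap_ext 𝕜 fun n => LinearMap.ext fun a => ?_) α
  simp only [LinearMap.comp_apply]
  rw [f.pullCochains_lof, twistedD_lof, twistedD_lof, map_add, f.pullCochains_lof,
    f.pullCochain_d]
  congr 1
  -- Viewed as a `mapRange`, the pull-back lets the sum over the support of $f^*t$ be rewritten as a
  -- sum over the support of $t$; the price is the side goal that zero forms act by zero.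
  have h : f.pullForms t = DFinsupp.mapRange (fun k => f.pullForm k) (fun _ => map_zero _) t :=
    rfl
  rw [h, DFinsupp.sum_mapRange_index, DFinsupp.sum, map_sum]
  · refine Finset.sum_congr rfl fun k _ => ?_
    rw [f.pullCochains_lof, f.pullCochain_act]
  · intro k
    rw [Cochain.act_zero, LinearMap.zero_apply, map_zero]

/-! ### Cocycles, coboundaries and the induced map on cohomology -/

theorem SimplicialMap.pullCochains_mem_parityCochains (f : SimplicialMap K L) (k₀ : V)
    (ρ : Representation 𝕜 (PiOne L (f.toFun k₀)) E) {p : ZMod 2}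
    {α : AllCochains L (f.toFun k₀) ρ} (hα : α ∈ ParityCochains L (f.toFun k₀) ρ p) :
    f.pullCochains k₀ ρ α ∈ ParityCochains K k₀ (f.pullRep k₀ ρ) p := fun n hn => by
  rw [f.pullCochains_apply, hα n hn, map_zero]

theorem SimplicialMap.pullCochains_mem_cocycles (f : SimplicialMap K L) (k₀ : V)
    (ρ : Representation 𝕜 (PiOne L (f.toFun k₀)) E) (t : AllForms L) {p : ZMod 2}
    {α : AllCochains L (f.toFun k₀) ρ} (hα : α ∈ Cocycles L (f.toFun k₀) ρ t p) :
    f.pullCochains k₀ ρ α ∈ Cocycles K k₀ (f.pullRep k₀ ρ) (f.pullForms t) p := by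
  refine ⟨f.pullCochains_mem_parityCochains k₀ ρ hα.1, ?_⟩
  have h : twistedD L (f.toFun k₀) ρ t α = 0 := hα.2
  rw [SetLike.mem_coe, LinearMap.mem_ker, ← f.pullCochains_twistedD, h, map_zero]

theorem SimplicialMap.pullCochains_mem_coboundaries (f : SimplicialMap K L) (k₀ : V)
    (ρ : Representation 𝕜 (PiOne L (f.toFun k₀)) E) (t : AllForms L) {p : ZMod 2}
    {α : AllCochains L (f.toFun k₀) ρ} (hα : α ∈ Coboundaries L (f.toFun k₀) ρ t p) :
    f.pullCochains k₀ ρ α ∈ Coboundaries K k₀ (f.pullRep k₀ ρ) (f.pullForms t) p := by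
  obtain ⟨β, hβ, rfl⟩ := hα
  exact ⟨f.pullCochains k₀ ρ β, f.pullCochains_mem_parityCochains k₀ ρ hβ,
    (f.pullCochains_twistedD k₀ ρ t β).symm⟩

/-- The map `H^p(L, E, t) → H^p(K, f^*E, f^*t)`, `[α] ↦ [α ∘ f̃_•]`, induced by a simplicial map
`f : K → L`. -/
noncomputable def SimplicialMap.pullCoh (f : SimplicialMap K L) (k₀ : V)
    (ρ : Representation 𝕜 (PiOne L (f.toFun k₀)) E) (t : AllForms L) (p : ZMod 2) :
    TwistedCoh L (f.toFun k₀) ρ t p →ₗ[𝕜] TwistedCoh K k₀ (f.pullRep k₀ ρ) (f.pullForms t) p :=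
  Submodule.mapQ _ _
    ((f.pullCochains k₀ ρ).restrict fun _ hα => f.pullCochains_mem_cocycles k₀ ρ t hα)
    -- Membership in `submoduleOf` unfolds to membership of the underlying cochain in
    -- `Coboundaries`.
    fun _ hα => f.pullCochains_mem_coboundaries k₀ ρ t hα

theorem SimplicialMap.pullCoh_mk (f : SimplicialMap K L) (k₀ : V)
    (ρ : Representation 𝕜 (PiOne L (f.toFun k₀)) E) (t : AllForms L) (p : ZMod 2)
    (α : AllCochains L (f.toFun k₀) ρ) (hα : α ∈ Cocycles L (f.toFun k₀) ρ t p) :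
    f.pullCoh k₀ ρ t p (TwistedCoh.mk L (f.toFun k₀) ρ t p α hα) =
      TwistedCoh.mk K k₀ (f.pullRep k₀ ρ) (f.pullForms t) p (f.pullCochains k₀ ρ α)
        (f.pullCochains_mem_cocycles k₀ ρ t hα) :=
  rfl

/-! ### Comparison of classes and functoriality on cohomology -/

/-- Cochains for $\rho$ and for $\rho'$ have different types, but in each degree both are linear
maps $Du_n(\widetilde K)\to E$. Comparing these underlying maps avoids transporting cochains along
$\rho=\rho'$; once the equalities are substituted the two cochains coincide. -/
theorem TwistedCoh.congr_mk {k₀ : V} {ρ ρ' : Representation 𝕜 (PiOne K k₀) E}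
    {t t' : AllForms K} (hρ : ρ = ρ') (ht : t = t') (p : ZMod 2) {α : AllCochains K k₀ ρ}
    {α' : AllCochains K k₀ ρ'} (hα : α ∈ Cocycles K k₀ ρ t p)
    (hα' : α' ∈ Cocycles K k₀ ρ' t' p) (h : ∀ n, (α n).1 = (α' n).1) :
    TwistedCoh.congr hρ ht p (TwistedCoh.mk K k₀ ρ t p α hα) =
      TwistedCoh.mk K k₀ ρ' t' p α' hα' := by
  subst hρ
  subst ht
  obtain rfl : α = α' := DFinsupp.ext fun n => Subtype.ext (h n)
  rfl

/-- The cochain maps induced by simplicial maps are functorial. -/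
theorem SimplicialMap.pullCochain_comp (f : SimplicialMap K L) (g : SimplicialMap J K) (j₀ : X)
    (ρ : Representation 𝕜 (PiOne L ((f.comp g).toFun j₀)) E) (n : ℕ)
    (α : Cochain L ((f.comp g).toFun j₀) ρ n) :
    ((f.comp g).pullCochain j₀ ρ n α).1 =
      (g.pullCochain j₀ (f.pullRep (g.toFun j₀) ρ) n (f.pullCochain (g.toFun j₀) ρ n α)).1 := by
  refine LinearMap.ext fun x => ?_
  change α.1 (((f.comp g).lift j₀).du n x) =
    α.1 ((f.lift (g.toFun j₀)).du n ((g.lift j₀).du n x))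
  -- Both sides are values of the same linear map, so what remains is an equality in
  -- $Du_n(\widetilde L)$, in which no representation occurs.
  refine congrArg α.1 ?_
  rw [f.lift_comp g j₀]
  exact SimplicialMap.du_comp _ _ n x

theorem SimplicialMap.pullCochain_id (k₀ : V) (ρ : Representation 𝕜 (PiOne K k₀) E) (n : ℕ)
    (α : Cochain K k₀ ρ n) : ((SimplicialMap.id K).pullCochain k₀ ρ n α).1 = α.1 := by
  refine LinearMap.ext fun x => ?_
  change α.1 (((SimplicialMap.id K).lift k₀).du n x) = α.1 x
  refine congrArg α.1 ?_
  rw [SimplicialMap.lift_id k₀]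
  exact SimplicialMap.du_id n x

theorem TwistedCoh.linearMap_ext {k₀ : V} {ρ : Representation 𝕜 (PiOne K k₀) E} {t : AllForms K}
    {p : ZMod 2} {M : Type*} [AddCommGroup M] [Module 𝕜 M] {a b : TwistedCoh K k₀ ρ t p →ₗ[𝕜] M}
    (h : ∀ (α : AllCochains K k₀ ρ) (hα : α ∈ Cocycles K k₀ ρ t p),
      a (TwistedCoh.mk K k₀ ρ t p α hα) = b (TwistedCoh.mk K k₀ ρ t p α hα)) : a = b := by
  refine LinearMap.ext fun c => ?_
  obtain ⟨⟨α, hα⟩, rfl⟩ := Submodule.Quotient.mk_surjective _ c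
  exact h α hα

/-- Every class has a cocycle representative, and on representatives both sides are induced by
explicit cochain maps, so the identity reduces degree by degree to `pullCochain_comp`. -/
theorem SimplicialMap.pullCoh_comp (f : SimplicialMap K L) (g : SimplicialMap J K) (j₀ : X)
    (ρ : Representation 𝕜 (PiOne L ((f.comp g).toFun j₀)) E) (t : AllForms L) (p : ZMod 2) :
    (TwistedCoh.congr (f.pullRep_comp g j₀ ρ) (f.pullForms_comp g t) p).toLinearMap ∘ₗ
        (f.comp g).pullCoh j₀ ρ t p =
      g.pullCoh j₀ (f.pullRep (g.toFun j₀) ρ) (f.pullForms t) p ∘ₗ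
        f.pullCoh (g.toFun j₀) ρ t p :=
  TwistedCoh.linearMap_ext fun α hα =>
    TwistedCoh.congr_mk (f.pullRep_comp g j₀ ρ) (f.pullForms_comp g t) p
      ((f.comp g).pullCochains_mem_cocycles j₀ ρ t hα)
      (g.pullCochains_mem_cocycles j₀ (f.pullRep (g.toFun j₀) ρ) (f.pullForms t)
        (f.pullCochains_mem_cocycles (g.toFun j₀) ρ t hα))
      fun n => f.pullCochain_comp g j₀ ρ n (α n)

theorem SimplicialMap.pullCoh_id (k₀ : V) (ρ : Representation 𝕜 (PiOne K k₀) E)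
    (t : AllForms K) (p : ZMod 2) :
    (TwistedCoh.congr (SimplicialMap.pullRep_id k₀ ρ) (SimplicialMap.pullForms_id t)
        p).toLinearMap ∘ₗ (SimplicialMap.id K).pullCoh k₀ ρ t p = LinearMap.id :=
  TwistedCoh.linearMap_ext fun α hα =>
    TwistedCoh.congr_mk (SimplicialMap.pullRep_id k₀ ρ) (SimplicialMap.pullForms_id t) p
      ((SimplicialMap.id K).pullCochains_mem_cocycles k₀ ρ t hα) hα
      fun n => SimplicialMap.pullCochain_id k₀ ρ n (α n)

end Cohomology

end TwistedCohomology

theorem proposition4 {𝕜 : Type w} [RCLike 𝕜] {E : Type v} [AddCommGroup E]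
    [Module 𝕜 E] [Module ℝ E] [IsScalarTower ℝ 𝕜 E] [FiniteDimensional 𝕜 E] :
    -- every simplicial map `f : K → L` induces linear maps `Φ f` on twisted cohomology
    ∃ Φ : ∀ {V W : Type u} {K : AbstractSimplicialComplex V} {L : AbstractSimplicialComplex W}
        (f : SimplicialMap K L) (k₀ : V) (ρ : Representation 𝕜 (PiOne L (f.toFun k₀)) E)
        (t : AllForms L) (p : ZMod 2),
        TwistedCoh L (f.toFun k₀) ρ t p →ₗ[𝕜]
          TwistedCoh K k₀ (f.pullRep k₀ ρ) (f.pullForms t) p,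
      -- `f^* t` is a twist on `K`, and `Φ f` is induced by the cochain map `α ↦ α ∘ f̃_•`
      (∀ {V W : Type u} {K : AbstractSimplicialComplex V} {L : AbstractSimplicialComplex W}
        (f : SimplicialMap K L) (k₀ : V) (ρ : Representation 𝕜 (PiOne L (f.toFun k₀)) E)
        (t : AllForms L) (p : ZMod 2),
        ConnectedSpace (Realization K) → ConnectedSpace (Realization L) → IsTwist t →
          IsTwist (f.pullForms t) ∧
          ∀ (α : AllCochains L (f.toFun k₀) ρ) (hα : α ∈ Cocycles L (f.toFun k₀) ρ t p),
            ∃ hα' : f.pullCochains k₀ ρ α ∈ Cocycles K k₀ (f.pullRep k₀ ρ) (f.pullForms t) p,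
              Φ f k₀ ρ t p (TwistedCoh.mk L (f.toFun k₀) ρ t p α hα) =
                TwistedCoh.mk K k₀ (f.pullRep k₀ ρ) (f.pullForms t) p
                  (f.pullCochains k₀ ρ α) hα') ∧
      -- `Φ (f ∘ g) = Φ g ∘ Φ f`, where `(f ∘ g)^* = g^* f^*` on representations and on forms
      (∀ {U V W : Type u} {J : AbstractSimplicialComplex U} {K : AbstractSimplicialComplex V}
        {L : AbstractSimplicialComplex W} (f : SimplicialMap K L) (g : SimplicialMap J K) (j₀ : U)
        (ρ : Representation 𝕜 (PiOne L ((f.comp g).toFun j₀)) E)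
        (t : AllForms L) (p : ZMod 2),
        ConnectedSpace (Realization J) → ConnectedSpace (Realization K) →
        ConnectedSpace (Realization L) → IsTwist t →
          ∃ (hρ : (f.comp g).pullRep j₀ ρ = g.pullRep j₀ (f.pullRep (g.toFun j₀) ρ))
            (ht : (f.comp g).pullForms t = g.pullForms (f.pullForms t)),
            (TwistedCoh.congr hρ ht p).toLinearMap ∘ₗ Φ (f.comp g) j₀ ρ t p =
              Φ g j₀ (f.pullRep (g.toFun j₀) ρ) (f.pullForms t) p ∘ₗ
                Φ f (g.toFun j₀) ρ t p) ∧
      -- `Φ id = id`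
      (∀ {V : Type u} {K : AbstractSimplicialComplex V} (k₀ : V)
        (ρ : Representation 𝕜 (PiOne K k₀) E) (t : AllForms K) (p : ZMod 2),
        ConnectedSpace (Realization K) → IsTwist t →
          ∃ (hρ : (SimplicialMap.id K).pullRep k₀ ρ = ρ)
            (ht : (SimplicialMap.id K).pullForms t = t),
            (TwistedCoh.congr hρ ht p).toLinearMap ∘ₗ Φ (SimplicialMap.id K) k₀ ρ t p =
              LinearMap.id) := by
  refine ⟨fun f k₀ ρ t p => f.pullCoh k₀ ρ t p, ?_, ?_, ?_⟩
  · intro V W K L f k₀ ρ t p _ _ ht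
    exact ⟨ht.pullForms f, fun α hα =>
      ⟨f.pullCochains_mem_cocycles k₀ ρ t hα, f.pullCoh_mk k₀ ρ t p α hα⟩⟩
  · intro U V W J K L f g j₀ ρ t p _ _ _ _
    exact ⟨f.pullRep_comp g j₀ ρ, f.pullForms_comp g t, f.pullCoh_comp g j₀ ρ t p⟩
  · intro V K k₀ ρ t p _ _
    exact ⟨SimplicialMap.pullRep_id k₀ ρ, SimplicialMap.pullForms_id t,
      SimplicialMap.pullCoh_id k₀ ρ t p⟩
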